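/- Let $\Bbbk$ be an algebraically closed field of characteristic $0$, let $n,d\ge 0$, and let $\mathcal S=\Bbbk[X_0,\dots,X_n]$ and $\mathcal R=\Bbbk[Y_0,\dots,Y_n]$ with their standard gradings, where $\mathcal R$ acts on $\mathcal S$ by differentiation, $Y_i\circ F=\partial F/\partial X_i$, and $\mathcal R$ is the homogeneous coordinate ring of $\mathbb P^n$. For a $0$-dimensional closed subscheme $Z\subset\mathbb P^n$ (possibly empty) let $I(Z)\subseteq\mathcal R$ be its saturated homogeneous ideal and let $\mathrm{HF}_Z(i)=\dim_{\Bbbk}\mathcal R_i/I(Z)_i$ be its Hilbert function. The scheme $Z$ is *apolar* to a form $F\in\mathcal S_d$ if $I(Z)\subseteq\mathrm{Ann}(F)=\{G\in\mathcal R : G\circ F=0\}$, and *$d$-regular* if $\mathrm{reg}(Z)=\min\{i\in\mathbb N : \mathrm{HF}_Z(i)=\mathrm{HF}_Z(i+1)=\mathrm{len}(Z)\}\le d$. Let $F\in\mathcal S_d$, and let $Z\subset\mathbb P^n$ be a $0$-dimensional scheme all of whose irreducible components $Z_1,\dots,Z_r$ (the local schemes at its points) have length at most $2$. If $Z$ is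 apolar to $F$ and has minimal length among all $0$-dimensional subschemes of $\mathbb P^n$ apolar to $F$, then $Z$ is $d$-regular. -/

import Mathlib

open MvPolynomial

namespace Apolarity

noncomputable section

/-- The standard grading of the polynomial ring `k[Y_0, …, Y_n]`. -/
abbrev stdGrading (k : Type*) [Field k] (n : ℕ) : ℕ → Submodule k (MvPolynomial (Fin (n + 1)) k) :=
  homogeneousSubmodule (Fin (n + 1)) k

instance stdGradedAlgebra (k : Type*) [Field k] (n : ℕ) : GradedAlgebra (stdGrading k n) :=
  MvPolynomial.gradedAlgebra

/-- The derivative `∂_β F = Y^β ∘ F`. On a monomial it is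
`∂_β (X^α) = (α! / (α - β)!) X^(α - β)` if `β ≤ α`, and `0` otherwise
(a descending factorial `α_i (α_i - 1) ⋯ (α_i - β_i + 1)` vanishes as soon as `α_i < β_i`). -/
def monomialDeriv {k : Type*} [Field k] {n : ℕ} (β : Fin (n + 1) →₀ ℕ)
    (F : MvPolynomial (Fin (n + 1)) k) : MvPolynomial (Fin (n + 1)) k :=
  ∑ α ∈ F.support,
    monomial (α - β) (((∏ i, (α i).descFactorial (β i) : ℕ) : k) * coeff α F)

/-- The apolarity action `G ∘ F` of `R = k[Y_0, …, Y_n]` on `S = k[X_0, …, X_n]` by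
differentiation. -/
def diffAction {k : Type*} [Field k] {n : ℕ}
    (G F : MvPolynomial (Fin (n + 1)) k) : MvPolynomial (Fin (n + 1)) k :=
  ∑ β ∈ G.support, coeff β G • monomialDeriv β F

/-- `Ann(F) = {G ∈ R : G ∘ F = 0}`. -/
def Ann {k : Type*} [Field k] {n : ℕ} (F : MvPolynomial (Fin (n + 1)) k) :
    Set (MvPolynomial (Fin (n + 1)) k) :=
  {G | diffAction G F = 0}

/-- A `0`-dimensional closed subscheme `Z` of `ℙⁿ = Proj k[Y_0, …, Y_n]`, given by its ideal `I(Z)`: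
a homogeneous ideal, saturated with respect to `(Y_0, …, Y_n)`, whose zero locus in `Proj` consists
of finitely many points. (The empty scheme, with `I(Z) = R`, is included.) -/
structure ZeroDimScheme (k : Type*) [Field k] (n : ℕ) where
  /-- The homogeneous ideal `I(Z)`. -/
  ideal : HomogeneousIdeal (stdGrading k n)
  saturated : ∀ f : MvPolynomial (Fin (n + 1)) k,
    (∀ i, X i * f ∈ ideal.toIdeal) → f ∈ ideal.toIdeal
  finite_zeroLocus :
    (ProjectiveSpectrum.zeroLocus (stdGrading k n) (ideal.toIdeal : Set _)).Finite

namespace ZeroDimScheme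

variable {k : Type*} [Field k] {n : ℕ}

/-- The finite set of points of `Z`. Each of them carries exactly one irreducible (equivalently,
connected) component of `Z`. -/
def points (Z : ZeroDimScheme k n) : Finset (ProjectiveSpectrum (stdGrading k n)) :=
  Z.finite_zeroLocus.toFinset

/-- The local ring `𝒪_{ℙⁿ,p}`: fractions `a / b` of homogeneous polynomials of the same degree
with `b` not in the homogeneous prime of `p`. -/
abbrev LocalRingAt (p : ProjectiveSpectrum (stdGrading k n)) : Type _ :=
  HomogeneousLocalization.AtPrime (stdGrading k n) p.asHomogeneousIdeal.toIdeal

/-- The stalk at `p` of the ideal sheaf of `Z`: the fractions of degree zero that lie in the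
extension of `I(Z)` to the localization of `R` at the prime of `p`. -/
def stalkIdeal (Z : ZeroDimScheme k n) (p : ProjectiveSpectrum (stdGrading k n)) :
    Ideal (LocalRingAt p) :=
  ((Z.ideal.toIdeal).map
      (algebraMap (MvPolynomial (Fin (n + 1)) k)
        (Localization.AtPrime p.asHomogeneousIdeal.toIdeal))).comap
    (algebraMap (LocalRingAt p) (Localization.AtPrime p.asHomogeneousIdeal.toIdeal))

/-- The length of the component of `Z` at `p`: the length of the local ring
`𝒪_{Z,p} = 𝒪_{ℙⁿ,p} / I_{Z,p}`. -/
def localLength (Z : ZeroDimScheme k n) (p : ProjectiveSpectrum (stdGrading k n)) : ℕ∞ :=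
  Module.length (LocalRingAt p) (LocalRingAt p ⧸ Z.stalkIdeal p)

/-- The length of `Z`: the sum of the lengths of its components. -/
def len (Z : ZeroDimScheme k n) : ℕ∞ :=
  ∑ p ∈ Z.points, Z.localLength p

/-- The Hilbert function `HF_Z(i) = dim_k R_i / I(Z)_i`, with `I(Z)_i = I(Z) ∩ R_i`. -/
def HF (Z : ZeroDimScheme k n) (i : ℕ) : ℕ :=
  Module.finrank k
    (stdGrading k n i ⧸
      (Z.ideal.toIdeal.restrictScalars k).comap (stdGrading k n i).subtype)

/-- The regularity of `Z`: the least `i` with `HF_Z(i) = HF_Z(i+1) = len(Z)`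
(with value `⊤` if there were no such `i`). -/
def reg (Z : ZeroDimScheme k n) : ℕ∞ :=
  ⨅ i ∈ {i : ℕ | (Z.HF i : ℕ∞) = Z.len ∧ (Z.HF (i + 1) : ℕ∞) = Z.len}, (i : ℕ∞)

/-- `Z` is regular in degree `d`. -/
def IsRegularInDegree (Z : ZeroDimScheme k n) (d : ℕ) : Prop :=
  Z.reg ≤ d

/-- `Z` is apolar to `F`: `I(Z) ⊆ Ann(F)`. -/
def IsApolar (Z : ZeroDimScheme k n) (F : MvPolynomial (Fin (n + 1)) k) : Prop :=
  (Z.ideal.toIdeal : Set _) ⊆ Ann F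

/-- `Z` has minimal length among the `0`-dimensional schemes in `ℙⁿ` apolar to `F`. -/
def IsMinimalApolar (Z : ZeroDimScheme k n) (F : MvPolynomial (Fin (n + 1)) k) : Prop :=
  Z.IsApolar F ∧ ∀ Z' : ZeroDimScheme k n, Z'.IsApolar F → Z.len ≤ Z'.len

end ZeroDimScheme

end

end Apolarity

/-! Over an algebraically closed field, a component of length at most 2 is a reduced point `a` or a
point with a tangent vector `v`. So a form `G` lies in `I(Z)` exactly when `G(a) = 0` and the
derivative of `G` at `a` along `v` vanishes, for every component (`exists_forall_mem_localIdeal_iff`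
locally, `mem_ideal_of_forall_points` to globalise). In characteristic 0, apolarity of `Z` to `F`
means that the functional which `F` defines on forms of degree `d` kills `I(Z)_d` (`isApolar_iff`),
hence is a linear combination of these evaluations and derivatives.

Minimality forces these conditions to be linearly independent in degree `d`
(`imposeIndependentConditions_of_minimal`). A relation involving a derivative could be subtracted to
delete a tangent vector, and a relation among values involving a reduced point could be subtracted
to delete that point. There remain relations `∑ γ_p G(a_p) = 0` supported at nonreduced points.
Applied to `l · ∂_w G`, with `l` a linear form, such a relation becomes one among derivatives along
the single direction `w`. Taking `w = v_p` for some `γ_p ≠ 0`, it deletes `v_p` and only tilts the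
vectors at points already nonreduced. Each case gives a shorter apolar scheme (`tangentScheme`).

Independence in degree `d` passes to degree `d + 1` by multiplying with linear forms, so the Hilbert
function equals the length in both degrees (`HF_eq_sum_tangentLength`). -/

namespace Apolarity

noncomputable section

variable {k : Type*} [Field k] {n : ℕ}

/-! ### Values and directional derivatives of forms. -/

/-- Substituting `ℓ • a` into a form of degree `e` gives `G(a) ℓ ^ e`. -/
lemma aeval_mul_of_isHomogeneous {A : Type*} [CommRing A] [Algebra k A] {e : ℕ}
    {G : MvPolynomial (Fin (n + 1)) k} (hG : G.IsHomogeneous e) (a : Fin (n + 1) → k) (l : A) :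
    aeval (fun i => algebraMap k A (a i) * l) G = algebraMap k A (eval a G) * l ^ e := by
  rw [aeval_def, eval₂_eq', eval_eq', map_sum, Finset.sum_mul]
  refine Finset.sum_congr rfl fun d hd => ?_
  have hde : ∑ i, d i = e := by
    rw [hG.degree_eq_sum_deg_support hd]
    exact (Finset.sum_subset (Finset.subset_univ _) (by simp)).symm
  simp only [mul_pow, Finset.prod_mul_distrib, Finset.prod_pow_eq_pow_sum, hde, map_mul, map_prod,
    map_pow]
  ring

lemma eval_smul_of_isHomogeneous {e : ℕ} {G : MvPolynomial (Fin (n + 1)) k}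
    (hG : G.IsHomogeneous e) (t : k) (a : Fin (n + 1) → k) :
    eval (t • a) G = t ^ e * eval a G := by
  have := aeval_mul_of_isHomogeneous hG a t
  simp only [Algebra.algebraMap_self, RingHom.id_apply, aeval_eq_eval] at this
  rw [mul_comm, ← this]
  congr 2
  ext i
  simp [mul_comm]

/-- The derivative of a polynomial at the point `a` in the direction `v`. -/
def jet (a v : Fin (n + 1) → k) : MvPolynomial (Fin (n + 1)) k →ₗ[k] k :=
  ∑ i, v i • ((aeval a).toLinearMap ∘ₗ (pderiv i).toLinearMap)

lemma jet_apply (a v : Fin (n + 1) → k) (G : MvPolynomial (Fin (n + 1)) k) :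
    jet a v G = ∑ i, v i * eval a (pderiv i G) := by
  simp [jet, aeval_eq_eval]

lemma jet_zero_right (a : Fin (n + 1) → k) (G : MvPolynomial (Fin (n + 1)) k) :
    jet a 0 G = 0 := by
  simp [jet_apply]

lemma jet_smul_right (a v : Fin (n + 1) → k) (t : k) (G : MvPolynomial (Fin (n + 1)) k) :
    jet a (t • v) G = t * jet a v G := by
  simp [jet_apply, Finset.mul_sum, mul_assoc]

lemma jet_sub_right (a v w : Fin (n + 1) → k) (G : MvPolynomial (Fin (n + 1)) k) :
    jet a (v - w) G = jet a v G - jet a w G := by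
  simp [jet_apply, sub_mul, Finset.sum_sub_distrib]

lemma jet_mul (a v : Fin (n + 1) → k) (G H : MvPolynomial (Fin (n + 1)) k) :
    jet a v (G * H) = eval a G * jet a v H + eval a H * jet a v G := by
  simp only [jet_apply, Finset.mul_sum, ← Finset.sum_add_distrib]
  refine Finset.sum_congr rfl fun i _ => ?_
  simp only [Derivation.leibniz, smul_eq_mul, map_add, map_mul]
  ring

lemma jet_X (a v : Fin (n + 1) → k) (i : Fin (n + 1)) : jet a v (X i) = v i := by
  rw [jet_apply, Finset.sum_eq_single i]
  · simp
  · intro j _ hj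
    rw [pderiv_X_of_ne hj.symm]
    simp
  · simp

lemma jet_C (a v : Fin (n + 1) → k) (c : k) : jet a v (C c) = 0 := by
  simp [jet_apply]

/-- The partial derivatives scale by `t ^ (e - 1)` and the direction contributes the missing factor
`t`; constants are treated apart because of truncated subtraction. -/
lemma jet_smul_of_isHomogeneous {e : ℕ} {G : MvPolynomial (Fin (n + 1)) k}
    (hG : G.IsHomogeneous e) (t : k) (a v : Fin (n + 1) → k) :
    jet (t • a) (t • v) G = t ^ e * jet a v G := by
  rcases e with _ | e
  · rw [totalDegree_eq_zero_iff_eq_C.mp ((totalDegree_zero_iff_isHomogeneous (p := G)).mpr hG)]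
    simp [jet_C]
  · simp only [jet_apply, Finset.mul_sum]
    refine Finset.sum_congr rfl fun i _ => ?_
    rw [eval_smul_of_isHomogeneous (hG.pderiv (i := i))]
    simp only [Pi.smul_apply, smul_eq_mul, Nat.add_sub_cancel]
    ring

lemma decompose_eq_homogeneousComponent (G : MvPolynomial (Fin (n + 1)) k) (e : ℕ) :
    (DirectSum.decompose (stdGrading k n) G e : MvPolynomial (Fin (n + 1)) k) =
      homogeneousComponent e G :=
  decomposition.decompose'_apply G e

lemma homogeneousComponent_mul_of_isHomogeneous {G H : MvPolynomial (Fin (n + 1)) k} {m : ℕ}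
    (hH : H.IsHomogeneous m) (e : ℕ) :
    homogeneousComponent (e + m) (G * H) = homogeneousComponent e G * H := by
  rw [← decompose_eq_homogeneousComponent, ← decompose_eq_homogeneousComponent]
  exact DirectSum.coe_decompose_mul_add_of_right_mem (stdGrading k n) hH

/-- A function of `t` that is a sum of `t ^ e * c e` vanishes identically only if all `c e` do. -/
lemma eq_zero_of_forall_sum_pow_mul_eq_zero [Infinite k] (N : ℕ) (c : ℕ → k)
    (h : ∀ t : k, ∑ e ∈ Finset.range N, t ^ e * c e = 0) {e : ℕ} (he : e < N) : c e = 0 := by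
  have hp : (∑ e ∈ Finset.range N, Polynomial.C (c e) * Polynomial.X ^ e) = 0 := by
    refine Polynomial.funext fun t => ?_
    rw [Polynomial.eval_finsetSum, Polynomial.eval_zero, ← h t]
    refine Finset.sum_congr rfl fun i _ => ?_
    rw [Polynomial.eval_mul, Polynomial.eval_C, Polynomial.eval_pow, Polynomial.eval_X, mul_comm]
  have := congrArg (fun p => Polynomial.coeff p e) hp
  simpa [Polynomial.finsetSum_coeff, Polynomial.coeff_C_mul, Polynomial.coeff_X_pow, he] using this

/-! ### Ideals of tangent vectors and Taylor expansion. -/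

/-- The ideal of polynomials vanishing to first order, in the direction `v`, along the line through
`a`. -/
def tangentIdeal (a v : Fin (n + 1) → k) : Ideal (MvPolynomial (Fin (n + 1)) k) where
  -- Asking for all `t` makes the ideal homogeneous over an infinite field; for forms, `t = 1`
  -- suffices.
  carrier := {G | ∀ t : k, eval (t • a) G = 0 ∧ jet (t • a) (t • v) G = 0}
  zero_mem' _ := by simp
  add_mem' hG hH t := by simp [(hG t).1, (hG t).2, (hH t).1, (hH t).2]
  smul_mem' c G hG t := by simp [jet_mul, (hG t).1, (hG t).2]

lemma mem_tangentIdeal {a v : Fin (n + 1) → k} {G : MvPolynomial (Fin (n + 1)) k} :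
    G ∈ tangentIdeal a v ↔ ∀ t : k, eval (t • a) G = 0 ∧ jet (t • a) (t • v) G = 0 :=
  Iff.rfl

lemma mem_tangentIdeal_of_isHomogeneous {a v : Fin (n + 1) → k} {e : ℕ}
    {G : MvPolynomial (Fin (n + 1)) k} (hG : G.IsHomogeneous e) :
    G ∈ tangentIdeal a v ↔ eval a G = 0 ∧ jet a v G = 0 := by
  refine ⟨fun h => by simpa using h 1, fun h t => ?_⟩
  rw [eval_smul_of_isHomogeneous hG, jet_smul_of_isHomogeneous hG, h.1, h.2]
  simp

/-- Both conditions are polynomial in `t`, and the coefficient of `t ^ e` is the same condition on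
the component of degree `e`. -/
lemma homogeneousComponent_mem_tangentIdeal [Infinite k] {a v : Fin (n + 1) → k}
    {G : MvPolynomial (Fin (n + 1)) k} (hG : G ∈ tangentIdeal a v) (e : ℕ) :
    homogeneousComponent e G ∈ tangentIdeal a v := by
  by_cases he : e < G.totalDegree + 1
  · rw [mem_tangentIdeal_of_isHomogeneous (homogeneousComponent_isHomogeneous e G)]
    constructor
    · refine eq_zero_of_forall_sum_pow_mul_eq_zero _
        (fun e => eval a (homogeneousComponent e G)) (fun t => ?_) he
      rw [← (hG t).1]
      conv_rhs => rw [← sum_homogeneousComponent G, map_sum]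
      exact Finset.sum_congr rfl fun i _ =>
        (eval_smul_of_isHomogeneous (homogeneousComponent_isHomogeneous i G) t a).symm
    · refine eq_zero_of_forall_sum_pow_mul_eq_zero _
        (fun e => jet a v (homogeneousComponent e G)) (fun t => ?_) he
      rw [← (hG t).2]
      conv_rhs => rw [← sum_homogeneousComponent G, map_sum]
      exact Finset.sum_congr rfl fun i _ =>
        (jet_smul_of_isHomogeneous (homogeneousComponent_isHomogeneous i G) t a v).symm
  · rw [homogeneousComponent_eq_zero e G (by omega)]
    exact zero_mem _

lemma tangentIdeal_isHomogeneous [Infinite k] (a v : Fin (n + 1) → k) :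
    (tangentIdeal a v).IsHomogeneous (stdGrading k n) := by
  intro e G hG
  rw [decompose_eq_homogeneousComponent]
  exact homogeneousComponent_mem_tangentIdeal hG e

/-- By the Leibniz rule. Thus a prime containing the ideal of a tangent vector contains the ideal of
its point. -/
lemma sq_mem_tangentIdeal {a : Fin (n + 1) → k} (v : Fin (n + 1) → k)
    {G : MvPolynomial (Fin (n + 1)) k} (hG : G ∈ tangentIdeal a 0) :
    G ^ 2 ∈ tangentIdeal a v := by
  intro t
  simp [sq, jet_mul, (hG t).1]

lemma mem_tangentIdeal_of_forall_X_mul_mem [Infinite k] {a : Fin (n + 1) → k} (ha : a ≠ 0)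
    {v : Fin (n + 1) → k} {G : MvPolynomial (Fin (n + 1)) k}
    (hG : ∀ i, X i * G ∈ tangentIdeal a v) : G ∈ tangentIdeal a v := by
  rw [mem_iff_homogeneousComponent_mem (tangentIdeal_isHomogeneous a v)]
  intro e
  have hGe := homogeneousComponent_isHomogeneous e G
  rw [mem_tangentIdeal_of_isHomogeneous hGe]
  obtain ⟨i, hi : a i ≠ 0⟩ := Function.ne_iff.mp ha
  have h := homogeneousComponent_mem_tangentIdeal (hG i) (e + 1)
  rw [mul_comm, homogeneousComponent_mul_of_isHomogeneous (isHomogeneous_X k i),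
    mem_tangentIdeal_of_isHomogeneous (hGe.mul (isHomogeneous_X k i)), map_mul, eval_X, jet_mul,
    eval_X, jet_X] at h
  have h1 : eval a (homogeneousComponent e G) = 0 := by simpa [hi] using h.1
  exact ⟨h1, by simpa [h1, hi] using h.2⟩

/-- First order Taylor expansion around the line through `a`, modulo an ideal containing the
products of the linear forms `X i - a i * l`. -/
lemma taylor_mem (a : Fin (n + 1) → k) (l : MvPolynomial (Fin (n + 1)) k)
    (Q : Ideal (MvPolynomial (Fin (n + 1)) k))
    (hQ : ∀ i j, (X i - C (a i) * l) * (X j - C (a j) * l) ∈ Q)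
    (G : MvPolynomial (Fin (n + 1)) k) :
    G - aeval (fun i => C (a i) * l) G -
      ∑ i, (X i - C (a i) * l) * aeval (fun i => C (a i) * l) (pderiv i G) ∈ Q := by
  induction G using MvPolynomial.induction_on with
  | C c => simp [algebraMap_eq]
  | add p q hp hq =>
    convert Q.add_mem hp hq using 1
    simp only [map_add, mul_add, Finset.sum_add_distrib]
    ring
  -- Write `X i = a i * l + (X i - a i * l)`: the second summand times the first-order term of `p`
  -- falls into `Q`.
  | mul_X p i hp =>
    have h1 := Q.mul_mem_left (X i) hp
    have h2 : ∑ j, (X i - C (a i) * l) * (X j - C (a j) * l) *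
        aeval (fun i => C (a i) * l) (pderiv j p) ∈ Q :=
      Q.sum_mem fun j _ => Q.mul_mem_right _ (hQ i j)
    convert Q.add_mem h1 h2 using 1
    have hs : ∑ j, (X j - C (a j) * l) * aeval (fun i => C (a i) * l) (pderiv j (p * X i)) =
        C (a i) * l * ∑ j, (X j - C (a j) * l) * aeval (fun i => C (a i) * l) (pderiv j p) +
        (X i - C (a i) * l) * aeval (fun i => C (a i) * l) p := by
      rw [Finset.mul_sum]
      have : (X i - C (a i) * l) * aeval (fun i => C (a i) * l) p = ∑ j,
          (X j - C (a j) * l) * (aeval (fun i => C (a i) * l) p *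
            aeval (fun i => C (a i) * l) (pderiv j (X i : MvPolynomial (Fin (n + 1)) k))) := by
        rw [Finset.sum_eq_single i]
        · simp
        · intro j _ hj
          rw [pderiv_X_of_ne hj.symm]
          simp
        · simp
      rw [this, ← Finset.sum_add_distrib]
      refine Finset.sum_congr rfl fun j _ => ?_
      simp only [Derivation.leibniz, smul_eq_mul, map_add, map_mul, aeval_X]
      ring
    rw [hs]
    have h3 : ∑ j, (X i - C (a i) * l) * (X j - C (a j) * l) *
        aeval (fun i => C (a i) * l) (pderiv j p) = (X i - C (a i) * l) *
        ∑ j, (X j - C (a j) * l) * aeval (fun i => C (a i) * l) (pderiv j p) := by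
      rw [Finset.mul_sum]
      exact Finset.sum_congr rfl fun j _ => mul_assoc _ _ _
    rw [h3, map_mul, aeval_X]
    ring

/-- The Taylor expansion of a form. -/
lemma taylor_mem_of_isHomogeneous (a : Fin (n + 1) → k) (l : MvPolynomial (Fin (n + 1)) k)
    (Q : Ideal (MvPolynomial (Fin (n + 1)) k))
    (hQ : ∀ i j, (X i - C (a i) * l) * (X j - C (a j) * l) ∈ Q)
    {G : MvPolynomial (Fin (n + 1)) k} {e : ℕ} (hG : G.IsHomogeneous e) :
    G - C (eval a G) * l ^ e -
      l ^ (e - 1) * ∑ i, C (eval a (pderiv i G)) * (X i - C (a i) * l) ∈ Q := by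
  convert taylor_mem a l Q hQ G using 2
  · congr 1
    exact (aeval_mul_of_isHomogeneous hG a l).symm
  · rw [Finset.mul_sum]
    refine Finset.sum_congr rfl fun i _ => ?_
    have := aeval_mul_of_isHomogeneous (hG.pderiv (i := i)) a l
    rw [algebraMap_eq] at this
    rw [this]
    ring

/-- A linear form with value one at a given nonzero vector. -/
lemma exists_linear_form_eval_eq_one {a : Fin (n + 1) → k} (ha : a ≠ 0) :
    ∃ l : MvPolynomial (Fin (n + 1)) k, l.IsHomogeneous 1 ∧ eval a l = 1 := by
  obtain ⟨i, hi : a i ≠ 0⟩ := Function.ne_iff.mp ha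
  exact ⟨C (a i)⁻¹ * X i, isHomogeneous_C_mul_X _ _, by simp [hi]⟩

/-! ### Rational points of projective space. -/

/-- The point `p` of `ℙⁿ` is the `k`-rational point with homogeneous coordinates `a`. -/
structure HasCoordinates (p : ProjectiveSpectrum (stdGrading k n)) (a : Fin (n + 1) → k) :
    Prop where
  ne_zero : a ≠ 0
  eq_tangentIdeal : p.asHomogeneousIdeal.toIdeal = tangentIdeal a 0

lemma HasCoordinates.mem_iff {p : ProjectiveSpectrum (stdGrading k n)} {a : Fin (n + 1) → k}
    (h : HasCoordinates p a) {G : MvPolynomial (Fin (n + 1)) k} {e : ℕ} (hG : G.IsHomogeneous e) :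
    G ∈ p.asHomogeneousIdeal.toIdeal ↔ eval a G = 0 := by
  rw [h.eq_tangentIdeal, mem_tangentIdeal_of_isHomogeneous hG, jet_zero_right]
  simp

lemma irrelevant_le_of_forall_X_mem {I : HomogeneousIdeal (stdGrading k n)}
    (h : ∀ i, X i ∈ I.toIdeal) : HomogeneousIdeal.irrelevant (stdGrading k n) ≤ I := by
  intro f hf
  rw [HomogeneousIdeal.mem_irrelevant_iff, GradedRing.proj_apply,
    decompose_eq_homogeneousComponent, homogeneousComponent_zero, C_eq_zero] at hf
  have : f ∈ Ideal.span (Set.range (X : Fin (n + 1) → MvPolynomial (Fin (n + 1)) k)) := by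
    rw [← Set.image_univ, mem_ideal_span_X_image]
    intro m hm
    by_contra! hc
    have : m = 0 := by
      ext i
      exact hc i (Set.mem_univ i)
    rw [this, mem_support_iff] at hm
    exact hm hf
  refine (Ideal.span_le.mpr ?_ : _ ≤ I.toIdeal) this
  rintro _ ⟨i, rfl⟩
  exact h i

/-- Every nonzero vector is the vector of homogeneous coordinates of a point. -/
lemma exists_hasCoordinates [Infinite k] {a : Fin (n + 1) → k} (ha : a ≠ 0) :
    ∃ p : ProjectiveSpectrum (stdGrading k n), HasCoordinates p a := by
  have hne : tangentIdeal a 0 ≠ ⊤ := by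
    rw [Ideal.ne_top_iff_one, mem_tangentIdeal]
    intro h
    simpa using (h 0).1
  refine ⟨⟨⟨tangentIdeal a 0, tangentIdeal_isHomogeneous a 0⟩, ?_, ?_⟩, ha, rfl⟩
  · refine (tangentIdeal_isHomogeneous a 0).isPrime_of_homogeneous_mem_or_mem hne ?_
    rintro x y ⟨i, hx : x.IsHomogeneous i⟩ ⟨j, hy : y.IsHomogeneous j⟩ hxy
    rw [mem_tangentIdeal_of_isHomogeneous (hx.mul hy)] at hxy
    rw [mem_tangentIdeal_of_isHomogeneous hx, mem_tangentIdeal_of_isHomogeneous hy]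
    simpa [jet_zero_right] using hxy
  · intro h
    obtain ⟨i, hi⟩ := Function.ne_iff.mp ha
    have hX : X i ∈ HomogeneousIdeal.irrelevant (stdGrading k n) := by
      rw [HomogeneousIdeal.mem_irrelevant_iff, GradedRing.proj_apply,
        decompose_eq_homogeneousComponent, homogeneousComponent_zero, coeff_zero_X, C_0]
    have := (mem_tangentIdeal_of_isHomogeneous (isHomogeneous_X k i)).mp (h hX)
    exact hi (by simpa using this.1)

/-- Rational points are closed. -/
lemma HasCoordinates.eq_of_le {p q : ProjectiveSpectrum (stdGrading k n)} {a : Fin (n + 1) → k}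
    (h : HasCoordinates p a)
    (hpq : p.asHomogeneousIdeal.toIdeal ≤ q.asHomogeneousIdeal.toIdeal) : q = p := by
  obtain ⟨l, hl, hla⟩ := exists_linear_form_eval_eq_one h.ne_zero
  have hN : ∀ i, X i - C (a i) * l ∈ q.asHomogeneousIdeal.toIdeal := fun i =>
    hpq ((h.mem_iff ((isHomogeneous_X k i).sub (hl.C_mul (a i)))).mpr (by simp [hla]))
  have hlq : l ∉ q.asHomogeneousIdeal.toIdeal := by
    intro hlq
    refine q.not_irrelevant_le (irrelevant_le_of_forall_X_mem fun i => ?_)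
    have := add_mem (hN i) (Ideal.mul_mem_left _ (C (a i)) hlq)
    simpa using this
  refine ProjectiveSpectrum.ext (HomogeneousIdeal.toIdeal_injective (le_antisymm ?_ hpq))
  intro G hG
  refine (mem_iff_homogeneousComponent_mem p.asHomogeneousIdeal.isHomogeneous G).mpr fun e => ?_
  have hGe := homogeneousComponent_isHomogeneous e G
  have hGq := homogeneousComponent_mem_of_mem q.asHomogeneousIdeal.isHomogeneous hG e
  rw [h.mem_iff hGe]
  by_contra hne
  -- Modulo `q` every `X i` is `a i * l`, so the component is congruent to its value at `a` times `l
  -- ^ e`; as `l ∉ q`, that value is zero.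
  have ht := taylor_mem_of_isHomogeneous a l q.asHomogeneousIdeal.toIdeal
    (fun i j => Ideal.mul_mem_right _ _ (hN i)) hGe
  have hs : l ^ (e - 1) * ∑ i, C (eval a (pderiv i (homogeneousComponent e G))) *
      (X i - C (a i) * l) ∈ q.asHomogeneousIdeal.toIdeal :=
    Ideal.mul_mem_left _ _ (Ideal.sum_mem _ fun i _ => Ideal.mul_mem_left _ _ (hN i))
  have hc : C (eval a (homogeneousComponent e G)) * l ^ e ∈ q.asHomogeneousIdeal.toIdeal := by
    have := sub_mem hGq (add_mem ht hs)
    simpa using this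
  have hc' := Ideal.mul_mem_left _ (C (eval a (homogeneousComponent e G))⁻¹) hc
  rw [← mul_assoc, ← C_mul, inv_mul_cancel₀ hne, C_1, one_mul] at hc'
  exact hlq (q.isPrime.mem_of_pow_mem _ hc')

/-! ### The points of `Z`, and membership in `I(Z)` tested locally. -/

namespace ZeroDimScheme

lemma mem_points {Z : ZeroDimScheme k n} {p : ProjectiveSpectrum (stdGrading k n)} :
    p ∈ Z.points ↔ Z.ideal.toIdeal ≤ p.asHomogeneousIdeal.toIdeal := by
  simp only [points, Set.Finite.mem_toFinset, ProjectiveSpectrum.mem_zeroLocus]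
  rfl

/-- Over an algebraically closed field the points of a `0`-dimensional scheme are rational. -/
lemma exists_hasCoordinates_of_mem_points [IsAlgClosed k] (Z : ZeroDimScheme k n)
    {p : ProjectiveSpectrum (stdGrading k n)} (hp : p ∈ Z.points) :
    ∃ a, HasCoordinates p a := by
  classical
  have : Infinite k := IsAlgClosed.instInfinite
  -- The rational points in the closure of `p`, finitely many as they lie on `Z`. By the
  -- Nullstellensatz the intersection of their primes lies in `p`; hence one of these primes does,
  -- and that point is `p`.
  set s := Z.points.filter fun q => (∃ a, HasCoordinates q a) ∧
    p.asHomogeneousIdeal.toIdeal ≤ q.asHomogeneousIdeal.toIdeal with hs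
  have hmem : ∀ x : Fin (n + 1) → k, x ≠ 0 → x ∈ zeroLocus k p.asHomogeneousIdeal.toIdeal →
      ∃ q ∈ s, HasCoordinates q x := by
    intro x hx hxp
    obtain ⟨q, hq⟩ := exists_hasCoordinates hx
    have hpq : p.asHomogeneousIdeal.toIdeal ≤ q.asHomogeneousIdeal.toIdeal := by
      intro G hG
      refine (mem_iff_homogeneousComponent_mem q.asHomogeneousIdeal.isHomogeneous G).mpr
        fun e => ?_
      rw [hq.mem_iff (homogeneousComponent_isHomogeneous e G), ← aeval_eq_eval]
      exact hxp _ (homogeneousComponent_mem_of_mem p.asHomogeneousIdeal.isHomogeneous hG e)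
    refine ⟨q, ?_, hq⟩
    rw [hs, Finset.mem_filter]
    exact ⟨mem_points.mpr ((mem_points.mp hp).trans hpq), ⟨x, hq⟩, hpq⟩
  have hne : s.Nonempty := by
    by_contra hemp
    refine p.not_irrelevant_le (irrelevant_le_of_forall_X_mem fun i => ?_)
    rw [← IsPrime.vanishingIdeal_zeroLocus (K := k) p.asHomogeneousIdeal.toIdeal,
      mem_vanishingIdeal_iff]
    intro x hx
    by_cases hx0 : x = 0
    · simp [hx0]
    · obtain ⟨q, hq, -⟩ := hmem x hx0 hx
      exact absurd ⟨q, hq⟩ hemp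
  have hinf : s.inf (fun q => q.asHomogeneousIdeal.toIdeal) ≤ p.asHomogeneousIdeal.toIdeal := by
    intro f hf
    rw [Submodule.mem_finsetInf] at hf
    rw [← IsPrime.vanishingIdeal_zeroLocus (K := k) p.asHomogeneousIdeal.toIdeal,
      mem_vanishingIdeal_iff]
    intro x hx
    rw [aeval_eq_eval]
    by_cases hx0 : x = 0
    · obtain ⟨q, hq⟩ := hne
      obtain ⟨a, ha⟩ := (Finset.mem_filter.mp hq).2.1
      have := hf q hq
      rw [ha.eq_tangentIdeal] at this
      simpa [hx0] using (this 0).1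
    · obtain ⟨q, hq, hqx⟩ := hmem x hx0 hx
      have := hf q hq
      rw [hqx.eq_tangentIdeal] at this
      simpa using (this 1).1
  obtain ⟨q, hq, hqp⟩ := p.isPrime.inf_le'.mp hinf
  obtain ⟨a, ha⟩ := (Finset.mem_filter.mp hq).2.1
  rw [ha.eq_of_le hqp]
  exact ⟨a, ha⟩

lemma mem_of_forall_mem_pow_span_X (Z : ZeroDimScheme k n) (N : ℕ)
    (f : MvPolynomial (Fin (n + 1)) k)
    (h : ∀ g ∈ Ideal.span (Set.range (X : Fin (n + 1) → MvPolynomial (Fin (n + 1)) k)) ^ N,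
      g * f ∈ Z.ideal.toIdeal) : f ∈ Z.ideal.toIdeal := by
  induction N generalizing f with
  | zero => simpa using h 1 (by simp)
  | succ N ih =>
    refine Z.saturated f fun i => ih _ fun g hg => ?_
    rw [← mul_assoc]
    refine h _ ?_
    rw [pow_succ]
    exact Ideal.mul_mem_mul hg (Ideal.subset_span ⟨i, rfl⟩)

/-- A form lies in the ideal of `Z` if it does so locally at all points of `Z`. -/
lemma mem_ideal_of_forall_points [IsAlgClosed k] (Z : ZeroDimScheme k n)
    {f : MvPolynomial (Fin (n + 1)) k} {m : ℕ} (hf : f.IsHomogeneous m)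
    (h : ∀ p ∈ Z.points, ∃ s ∉ p.asHomogeneousIdeal.toIdeal, s * f ∈ Z.ideal.toIdeal) :
    f ∈ Z.ideal.toIdeal := by
  have : Infinite k := IsAlgClosed.instInfinite
  -- The colon ideal `I(Z) : f`. It has no zero except possibly the origin, so it contains a power
  -- of `(X_0, …, X_n)`, and saturation gives `f ∈ I(Z)`.
  set J : Ideal (MvPolynomial (Fin (n + 1)) k) :=
    Submodule.comap (LinearMap.toSpanSingleton _ _ f) Z.ideal.toIdeal with hJ
  have hmemJ : ∀ s, s ∈ J ↔ s * f ∈ Z.ideal.toIdeal := fun s => Iff.rfl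
  have hcomp : ∀ s ∈ J, ∀ e, homogeneousComponent e s ∈ J := by
    intro s hs e
    rw [hmemJ, ← homogeneousComponent_mul_of_isHomogeneous hf]
    exact homogeneousComponent_mem_of_mem Z.ideal.isHomogeneous hs _
  have hsep : ∀ x : Fin (n + 1) → k, x ∈ zeroLocus k J → x = 0 := by
    intro x hx
    by_contra hx0
    obtain ⟨q, hq⟩ := exists_hasCoordinates hx0
    obtain ⟨s, hsq, hsJ⟩ : ∃ s ∉ q.asHomogeneousIdeal.toIdeal, s ∈ J := by
      by_cases hqZ : q ∈ Z.points
      · exact h q hqZ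
      · rw [mem_points, SetLike.not_le_iff_exists] at hqZ
        obtain ⟨g, hgI, hgq⟩ := hqZ
        exact ⟨g, hgq, Ideal.mul_mem_right _ _ hgI⟩
    refine hsq ((mem_iff_homogeneousComponent_mem q.asHomogeneousIdeal.isHomogeneous s).mpr
      fun e => ?_)
    rw [hq.mem_iff (homogeneousComponent_isHomogeneous e s), ← aeval_eq_eval]
    exact hx _ (hcomp s hsJ e)
  have hrad : Ideal.span (Set.range (X : Fin (n + 1) → MvPolynomial (Fin (n + 1)) k)) ≤
      J.radical := by
    rw [Ideal.span_le]
    rintro _ ⟨i, rfl⟩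
    rw [SetLike.mem_coe, ← vanishingIdeal_zeroLocus_eq_radical (K := k), mem_vanishingIdeal_iff]
    intro x hx
    simp [hsep x hx]
  obtain ⟨N, hN⟩ := Ideal.exists_pow_le_of_le_radical_of_fg hrad
    (Submodule.fg_span (Set.finite_range X))
  exact Z.mem_of_forall_mem_pow_span_X N f fun g hg => hN hg

end ZeroDimScheme

end

end Apolarity

namespace Apolarity

noncomputable section

/-! ### Quotients of length at most two of a local ring. -/

section LocalRing

open IsLocalRing

variable {A : Type*} [CommRing A]

lemma three_le_length_quotient {I J K : Ideal A} (hIJ : I < J) (hJK : J < K) (hK : K < ⊤) :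
    3 ≤ Module.length A (A ⧸ I) := by
  rw [Module.length_quotient]
  have h1 := Order.coheight_add_one_le hIJ
  have h2 := Order.coheight_add_one_le hJK
  have h3 := Order.coheight_add_one_le hK
  calc (3 : ℕ∞) = 0 + 1 + 1 + 1 := by norm_num
    _ ≤ Order.coheight (⊤ : Ideal A) + 1 + 1 + 1 := by gcongr; exact zero_le
    _ ≤ Order.coheight K + 1 + 1 := by gcongr
    _ ≤ Order.coheight J + 1 := by gcongr
    _ ≤ _ := h1

lemma two_le_length_quotient {I J : Ideal A} (hIJ : I < J) (hJ : J < ⊤) :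
    2 ≤ Module.length A (A ⧸ I) := by
  rw [Module.length_quotient]
  have h1 := Order.coheight_add_one_le hIJ
  have h2 := Order.coheight_add_one_le hJ
  calc (2 : ℕ∞) = 0 + 1 + 1 := by norm_num
    _ ≤ Order.coheight (⊤ : Ideal A) + 1 + 1 := by gcongr; exact zero_le
    _ ≤ Order.coheight J + 1 := by gcongr
    _ ≤ _ := h1

variable [IsLocalRing A]

lemma length_quotient_maximalIdeal : Module.length A (A ⧸ maximalIdeal A) = 1 := by
  rw [Module.length_eq_one_iff]
  exact isSimpleModule_iff_isCoatom.mpr (maximalIdeal.isMaximal A).out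

/-- Otherwise `I < I + (x) < 𝔪 < A` is a chain of length three. -/
lemma maximalIdeal_eq_sup_span_of_length_le_two {I : Ideal A}
    (hlen : Module.length A (A ⧸ I) ≤ 2) (hI : I ≤ maximalIdeal A) {x : A}
    (hx : x ∈ maximalIdeal A) (hxI : x ∉ I) : I ⊔ Ideal.span {x} = maximalIdeal A := by
  have hle : I ⊔ Ideal.span {x} ≤ maximalIdeal A :=
    sup_le hI ((Ideal.span_singleton_le_iff_mem _).mpr hx)
  by_contra hne
  have hlt : I < I ⊔ Ideal.span {x} :=
    lt_of_le_of_ne le_sup_left fun h =>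
      hxI (h ▸ Ideal.mem_sup_right (Ideal.mem_span_singleton_self x))
  have h3 := three_le_length_quotient hlt (lt_of_le_of_ne hle hne)
    (lt_top_iff_ne_top.mpr (maximalIdeal.isMaximal A).ne_top)
  exact absurd (h3.trans hlen) (by decide)

/-- If `y z ∉ I`, then `y ∈ 𝔪 = I + (y z)`, so `(1 - r z) y ∈ I` for some `r`; the first factor is a
unit, whence `y ∈ I`, a contradiction. -/
lemma mul_mem_of_length_le_two {I : Ideal A} (hlen : Module.length A (A ⧸ I) ≤ 2)
    (hI : I ≤ maximalIdeal A) {y z : A} (hy : y ∈ maximalIdeal A) (hz : z ∈ maximalIdeal A) :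
    y * z ∈ I := by
  by_contra hyz
  have hmem : y * z ∈ maximalIdeal A := Ideal.mul_mem_right _ _ hy
  have hsup := maximalIdeal_eq_sup_span_of_length_le_two hlen hI hmem hyz
  rw [← hsup, Submodule.mem_sup] at hy
  obtain ⟨i, hi, w, hw, hiw⟩ := hy
  obtain ⟨r, rfl⟩ := Ideal.mem_span_singleton'.mp hw
  have hunit : IsUnit (1 - r * z) := by
    by_contra hnu
    have := add_mem ((mem_maximalIdeal _).mpr hnu) (Ideal.mul_mem_left _ r hz)
    simp at this
  have hyI : y ∈ I := by
    have : (1 - r * z) * y ∈ I := by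
      convert hi using 1
      linear_combination -hiw
    exact (Ideal.unit_mul_mem_iff_mem I hunit).mp this
  exact hyz (Ideal.mul_mem_right _ _ hyI)

/-- The length of `A ⧸ I` is at most two if `𝔪` is spanned modulo `I` by any of its elements that
is not in `I`. -/
lemma length_quotient_le_two {I : Ideal A} (h : ∀ x ∈ maximalIdeal A, ∀ y ∈ maximalIdeal A, x ∉ I →
    ∃ r, y - r * x ∈ I) : Module.length A (A ⧸ I) ≤ 2 := by
  by_cases hI : I ≤ maximalIdeal A
  swap
  · have : I = ⊤ := by
      by_contra hne
      exact hI (le_maximalIdeal hne)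
    subst this
    have : Subsingleton (A ⧸ (⊤ : Ideal A)) := Ideal.Quotient.subsingleton_iff.mpr rfl
    simp
  -- The image of `𝔪` is zero or simple by hypothesis, and the remaining quotient is a quotient of
  -- the residue field.
  set N : Submodule A (A ⧸ I) := Submodule.map I.mkQ (maximalIdeal A) with hN
  have hadd := Module.length_eq_add_of_exact N.subtype N.mkQ N.injective_subtype N.mkQ_surjective
    (LinearMap.exact_subtype_mkQ N)
  have h1 : Module.length A N ≤ 1 := by
    by_cases hs : Subsingleton N
    · simp
    · rw [not_subsingleton_iff_nontrivial] at hs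
      have : IsSimpleModule A N := by
        rw [isSimpleModule_iff_toSpanSingleton_surjective]
        refine ⟨hs, ?_⟩
        rintro ⟨_, x, hx, rfl⟩ hx0 ⟨_, y, hy, rfl⟩
        have hxI : x ∉ I := by
          intro hxI
          exact hx0 (Subtype.ext ((Submodule.Quotient.mk_eq_zero I).mpr hxI))
        obtain ⟨r, hr⟩ := h x hx y hy hxI
        refine ⟨r, Subtype.ext ?_⟩
        exact ((Submodule.Quotient.eq I).mpr hr).symm
      rw [Module.length_eq_one]
  have h2 : Module.length A ((A ⧸ I) ⧸ N) ≤ 1 := by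
    rw [← length_quotient_maximalIdeal (A := A)]
    refine Module.length_le_of_surjective
      ((maximalIdeal A).liftQ (N.mkQ ∘ₗ I.mkQ) ?_) ?_
    · intro x hx
      rw [LinearMap.mem_ker, LinearMap.comp_apply]
      exact (Submodule.Quotient.mk_eq_zero N).mpr ⟨x, hx, rfl⟩
    · rw [← LinearMap.range_eq_top, Submodule.range_liftQ, LinearMap.range_eq_top]
      exact N.mkQ_surjective.comp I.mkQ_surjective
  rw [hadd]
  exact (add_le_add h1 h2).trans (by norm_num)

lemma length_quotient_le_one {I : Ideal A} (h : maximalIdeal A ≤ I) :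
    Module.length A (A ⧸ I) ≤ 1 := by
  rw [← length_quotient_maximalIdeal (A := A)]
  exact Module.length_le_of_surjective (Submodule.factor h) (Submodule.factor_surjective h)

end LocalRing

variable {k : Type*} [Field k] {n : ℕ}

/-! ### Components of length at most two are tangent vectors. -/

/-- The length of the scheme defined by the tangent vector `v` at a point: a reduced point if
`v = 0`. -/
def tangentLength (v : Fin (n + 1) → k) : ℕ :=
  open Classical in if v = 0 then 1 else 2

lemma tangentLength_zero : tangentLength (0 : Fin (n + 1) → k) = 1 :=
  if_pos rfl

lemma tangentLength_of_ne_zero {v : Fin (n + 1) → k} (hv : v ≠ 0) : tangentLength v = 2 :=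
  if_neg hv

lemma mk_mem_maximalIdeal_iff {p : ProjectiveSpectrum (stdGrading k n)}
    (c : HomogeneousLocalization.NumDenSameDeg (stdGrading k n)
      p.asHomogeneousIdeal.toIdeal.primeCompl) :
    (HomogeneousLocalization.mk c : ZeroDimScheme.LocalRingAt p) ∈
      IsLocalRing.maximalIdeal (ZeroDimScheme.LocalRingAt p) ↔
      (c.num : MvPolynomial (Fin (n + 1)) k) ∈ p.asHomogeneousIdeal.toIdeal := by
  rw [IsLocalRing.mem_maximalIdeal, mem_nonunits_iff,
    ← HomogeneousLocalization.isUnit_iff_isUnit_val, HomogeneousLocalization.val_mk,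
    Localization.mk_eq_mk', IsLocalization.AtPrime.isUnit_mk'_iff _
      p.asHomogeneousIdeal.toIdeal]
  exact not_not

namespace ZeroDimScheme

/-- The contraction of the stalk at `p` of `I(Z)` to the polynomial ring. -/
def localIdeal (Z : ZeroDimScheme k n) (p : ProjectiveSpectrum (stdGrading k n)) :
    Ideal (MvPolynomial (Fin (n + 1)) k) :=
  ((Z.ideal.toIdeal).map (algebraMap (MvPolynomial (Fin (n + 1)) k)
    (Localization.AtPrime p.asHomogeneousIdeal.toIdeal))).comap
    (algebraMap (MvPolynomial (Fin (n + 1)) k)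
      (Localization.AtPrime p.asHomogeneousIdeal.toIdeal))

lemma mem_localIdeal {Z : ZeroDimScheme k n} {p : ProjectiveSpectrum (stdGrading k n)}
    {G : MvPolynomial (Fin (n + 1)) k} :
    G ∈ Z.localIdeal p ↔
      ∃ s ∉ p.asHomogeneousIdeal.toIdeal, s * G ∈ Z.ideal.toIdeal := by
  rw [localIdeal, Ideal.mem_comap, IsLocalization.algebraMap_mem_map_algebraMap_iff
    p.asHomogeneousIdeal.toIdeal.primeCompl]
  rfl

lemma mem_localIdeal_of_mul_mem {Z : ZeroDimScheme k n}
    {p : ProjectiveSpectrum (stdGrading k n)} {s G : MvPolynomial (Fin (n + 1)) k}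
    (hs : s ∉ p.asHomogeneousIdeal.toIdeal) (h : s * G ∈ Z.localIdeal p) :
    G ∈ Z.localIdeal p := by
  obtain ⟨t, ht, hts⟩ := mem_localIdeal.mp h
  refine mem_localIdeal.mpr ⟨t * s, ?_, by rwa [mul_assoc]⟩
  exact fun h => (p.isPrime.mem_or_mem h).elim ht hs

lemma localIdeal_le {Z : ZeroDimScheme k n} {p : ProjectiveSpectrum (stdGrading k n)}
    (hp : p ∈ Z.points) : Z.localIdeal p ≤ p.asHomogeneousIdeal.toIdeal := by
  intro G hG
  obtain ⟨s, hs, hsG⟩ := mem_localIdeal.mp hG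
  exact (p.isPrime.mem_or_mem (mem_points.mp hp hsG)).resolve_left hs

lemma mk_mem_stalkIdeal_iff {Z : ZeroDimScheme k n} {p : ProjectiveSpectrum (stdGrading k n)}
    (c : HomogeneousLocalization.NumDenSameDeg (stdGrading k n)
      p.asHomogeneousIdeal.toIdeal.primeCompl) :
    (HomogeneousLocalization.mk c : LocalRingAt p) ∈ Z.stalkIdeal p ↔
      (c.num : MvPolynomial (Fin (n + 1)) k) ∈ Z.localIdeal p := by
  rw [stalkIdeal, Ideal.mem_comap, HomogeneousLocalization.algebraMap_apply,
    HomogeneousLocalization.val_mk, Localization.mk_eq_mk',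
    IsLocalization.mk'_mem_map_algebraMap_iff, mem_localIdeal]
  rfl

/-- The fraction `G / l ^ e` at a point where the linear form `l` does not vanish. -/
def fraction {p : ProjectiveSpectrum (stdGrading k n)} {l : MvPolynomial (Fin (n + 1)) k}
    (hl : l.IsHomogeneous 1) (hlp : l ∉ p.asHomogeneousIdeal.toIdeal)
    {G : MvPolynomial (Fin (n + 1)) k} {e : ℕ} (hG : G.IsHomogeneous e) : LocalRingAt p :=
  HomogeneousLocalization.mk ⟨e, ⟨G, hG⟩, ⟨l ^ e, by simpa using hl.pow e⟩,
    fun h => hlp (p.isPrime.mem_of_pow_mem _ h)⟩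

lemma fraction_mem_maximalIdeal_iff {p : ProjectiveSpectrum (stdGrading k n)}
    {l : MvPolynomial (Fin (n + 1)) k} (hl : l.IsHomogeneous 1)
    (hlp : l ∉ p.asHomogeneousIdeal.toIdeal) {G : MvPolynomial (Fin (n + 1)) k} {e : ℕ}
    (hG : G.IsHomogeneous e) :
    fraction hl hlp hG ∈ IsLocalRing.maximalIdeal (LocalRingAt p) ↔
      G ∈ p.asHomogeneousIdeal.toIdeal :=
  mk_mem_maximalIdeal_iff _

lemma fraction_mem_stalkIdeal_iff {Z : ZeroDimScheme k n}
    {p : ProjectiveSpectrum (stdGrading k n)}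
    {l : MvPolynomial (Fin (n + 1)) k} (hl : l.IsHomogeneous 1)
    (hlp : l ∉ p.asHomogeneousIdeal.toIdeal) {G : MvPolynomial (Fin (n + 1)) k} {e : ℕ}
    (hG : G.IsHomogeneous e) :
    fraction hl hlp hG ∈ Z.stalkIdeal p ↔ G ∈ Z.localIdeal p :=
  mk_mem_stalkIdeal_iff _

lemma algebraMap_mul_val_fraction {p : ProjectiveSpectrum (stdGrading k n)}
    {l : MvPolynomial (Fin (n + 1)) k} (hl : l.IsHomogeneous 1)
    (hlp : l ∉ p.asHomogeneousIdeal.toIdeal) {G : MvPolynomial (Fin (n + 1)) k} {e : ℕ}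
    (hG : G.IsHomogeneous e) :
    algebraMap _ (Localization.AtPrime p.asHomogeneousIdeal.toIdeal) (l ^ e) *
      (fraction hl hlp hG).val = algebraMap _ _ G := by
  rw [fraction, HomogeneousLocalization.val_mk, Localization.mk_eq_mk']
  exact IsLocalization.mk'_spec' (M := p.asHomogeneousIdeal.toIdeal.primeCompl) _ G
    ⟨l ^ e, fun h => hlp (p.isPrime.mem_of_pow_mem _ h)⟩

lemma stalkIdeal_le {Z : ZeroDimScheme k n} {p : ProjectiveSpectrum (stdGrading k n)}
    (hp : p ∈ Z.points) :
    Z.stalkIdeal p ≤ IsLocalRing.maximalIdeal (LocalRingAt p) := by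
  intro x hx
  obtain ⟨c, rfl⟩ := HomogeneousLocalization.mk_surjective x
  rw [mk_mem_stalkIdeal_iff] at hx
  exact (mk_mem_maximalIdeal_iff c).mpr (localIdeal_le hp hx)

/-- The residue field of a rational point is `k`. -/
lemma exists_sub_mem_maximalIdeal {p : ProjectiveSpectrum (stdGrading k n)}
    {a : Fin (n + 1) → k} (h : HasCoordinates p a) (r : LocalRingAt p) :
    ∃ (c : k), ∃ r' ∈ IsLocalRing.maximalIdeal (LocalRingAt p),
      r.val = algebraMap _ (Localization.AtPrime p.asHomogeneousIdeal.toIdeal)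
        (C c : MvPolynomial (Fin (n + 1)) k) + r'.val := by
  obtain ⟨⟨e, ⟨g, hg⟩, ⟨s, hs⟩, hsp⟩, rfl⟩ := HomogeneousLocalization.mk_surjective r
  have hg' : g.IsHomogeneous e := hg
  have hs' : s.IsHomogeneous e := hs
  have hsa : eval a s ≠ 0 := fun h0 => hsp ((h.mem_iff hs').mpr h0)
  set c := eval a g / eval a s with hc
  have hd : (g - C c * s).IsHomogeneous e := hg'.sub (hs'.C_mul c)
  refine ⟨c, HomogeneousLocalization.mk ⟨e, ⟨g - C c * s, hd⟩, ⟨s, hs⟩, hsp⟩, ?_, ?_⟩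
  · rw [mk_mem_maximalIdeal_iff]
    exact (h.mem_iff hd).mpr (by simp [hc, hsa])
  · rw [HomogeneousLocalization.val_mk, HomogeneousLocalization.val_mk, Localization.mk_eq_mk',
      IsLocalization.mk'_eq_iff_eq_mul, add_mul, IsLocalization.mk'_spec, ← map_mul, ← map_add]
    congr 1
    simp

/-- The structure of a component of length at most two at a rational point: it is either the reduced
point or a tangent vector. -/
theorem exists_forall_mem_localIdeal_iff (Z : ZeroDimScheme k n)
    {p : ProjectiveSpectrum (stdGrading k n)} (hp : p ∈ Z.points) {a : Fin (n + 1) → k}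
    (h : HasCoordinates p a) (hlen : Z.localLength p ≤ 2) :
    ∃ v : Fin (n + 1) → k,
      (∀ (e : ℕ) (G : MvPolynomial (Fin (n + 1)) k), G.IsHomogeneous e →
        (G ∈ Z.localIdeal p ↔ eval a G = 0 ∧ jet a v G = 0)) ∧
      Z.localLength p = tangentLength v := by
  obtain ⟨l, hl, hla⟩ := exists_linear_form_eval_eq_one h.ne_zero
  have hlp : l ∉ p.asHomogeneousIdeal.toIdeal := by
    rw [h.mem_iff hl, hla]
    exact one_ne_zero
  have hle := stalkIdeal_le hp
  rcases hle.eq_or_lt with heq | hlt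
  · refine ⟨0, fun e G hG => ?_, ?_⟩
    · rw [← fraction_mem_stalkIdeal_iff hl hlp hG, heq, fraction_mem_maximalIdeal_iff,
        h.mem_iff hG, jet_zero_right]
      simp
    · rw [tangentLength_zero, localLength, heq, length_quotient_maximalIdeal, Nat.cast_one]
  · have hmul : ∀ y ∈ IsLocalRing.maximalIdeal (LocalRingAt p),
        ∀ z ∈ IsLocalRing.maximalIdeal (LocalRingAt p), y * z ∈ Z.stalkIdeal p :=
      fun y hy z hz => mul_mem_of_length_le_two hlen hle hy hz
    have hN1 : ∀ i, (X i - C (a i) * l).IsHomogeneous 1 := fun i =>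
      (isHomogeneous_X k i).sub (hl.C_mul (a i))
    have hNp : ∀ i, X i - C (a i) * l ∈ p.asHomogeneousIdeal.toIdeal := fun i =>
      (h.mem_iff (hN1 i)).mpr (by simp [hla])
    have hQ : ∀ i j, (X i - C (a i) * l) * (X j - C (a j) * l) ∈ Z.localIdeal p := by
      intro i j
      have hij := hmul _ ((fraction_mem_maximalIdeal_iff hl hlp (hN1 i)).mpr (hNp i))
        _ ((fraction_mem_maximalIdeal_iff hl hlp (hN1 j)).mpr (hNp j))
      rw [fraction, fraction, ← HomogeneousLocalization.mk_mul, mk_mem_stalkIdeal_iff] at hij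
      exact hij
    -- `L b` represents the cotangent vector `b` at `a`. Since `𝔪 ^ 2` lies in the stalk ideal, a
    -- form vanishing at `a` is `l ^ (e - 1) * L (gradient)` modulo the local ideal.
    set L : (Fin (n + 1) → k) →ₗ[k] MvPolynomial (Fin (n + 1)) k :=
      ∑ i, (LinearMap.proj i : (Fin (n + 1) → k) →ₗ[k] k).smulRight (X i - C (a i) * l) with hL
    have hLapp : ∀ b, L b = ∑ i, C (b i) * (X i - C (a i) * l) := fun b => by
      simp [hL, smul_eq_C_mul]
    have hL1 : ∀ b, (L b).IsHomogeneous 1 := fun b => by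
      rw [hLapp]
      exact IsHomogeneous.sum _ _ _ fun i _ => (hN1 i).C_mul (b i)
    have hLp : ∀ b, L b ∈ p.asHomogeneousIdeal.toIdeal := fun b => by
      rw [hLapp]
      exact Ideal.sum_mem _ fun i _ => Ideal.mul_mem_left _ _ (hNp i)
    have hgrad : ∀ (e : ℕ) (G : MvPolynomial (Fin (n + 1)) k), G.IsHomogeneous e →
        eval a G = 0 → (G ∈ Z.localIdeal p ↔ L (fun i => eval a (pderiv i G)) ∈ Z.localIdeal p) := by
      intro e G hG hGa
      have ht := taylor_mem_of_isHomogeneous a l _ hQ hG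
      rw [hGa, C_0, zero_mul, sub_zero, ← hLapp fun i => eval a (pderiv i G)] at ht
      constructor
      · intro hGQ
        have := sub_mem hGQ ht
        rw [sub_sub_cancel] at this
        exact mem_localIdeal_of_mul_mem (fun h => hlp (p.isPrime.mem_of_pow_mem _ h)) this
      · intro hLQ
        have := add_mem ht (Ideal.mul_mem_left _ (l ^ (e - 1)) hLQ)
        rwa [sub_add_cancel] at this
    set U : Submodule k (Fin (n + 1) → k) :=
      ((Z.localIdeal p).restrictScalars k).comap L with hU
    have hmemU : ∀ b, b ∈ U ↔ L b ∈ Z.localIdeal p := fun b => Iff.rfl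
    obtain ⟨b₀, hb₀⟩ : ∃ b, b ∉ U := by
      by_contra! hall
      refine hlt.not_ge fun x hx => ?_
      obtain ⟨c, rfl⟩ := HomogeneousLocalization.mk_surjective x
      rw [mk_mem_maximalIdeal_iff] at hx
      rw [mk_mem_stalkIdeal_iff, hgrad c.deg _ c.num.2 ((h.mem_iff c.num.2).mp hx)]
      exact hall _
    obtain ⟨f, hf₀, hfU⟩ := Submodule.exists_le_ker_of_notMem hb₀
    -- `U` has codimension one: `𝔪` is generated modulo the stalk ideal by the class of `L b₀`, and
    -- coefficients matter only through their residue in `k`.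
    have hkey : ∀ b, ∃ c : k, b - c • b₀ ∈ U := by
      intro b
      set x₀ := fraction hl hlp (hL1 b₀)
      set x := fraction hl hlp (hL1 b)
      have hx₀ : x₀ ∈ IsLocalRing.maximalIdeal (LocalRingAt p) :=
        (fraction_mem_maximalIdeal_iff hl hlp _).mpr (hLp b₀)
      have hx₀' : x₀ ∉ Z.stalkIdeal p := fun hmem =>
        hb₀ ((fraction_mem_stalkIdeal_iff hl hlp _).mp hmem)
      have hx : x ∈ IsLocalRing.maximalIdeal (LocalRingAt p) :=
        (fraction_mem_maximalIdeal_iff hl hlp _).mpr (hLp b)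
      rw [← maximalIdeal_eq_sup_span_of_length_le_two hlen hle hx₀ hx₀', Submodule.mem_sup] at hx
      obtain ⟨y, hy, w, hw, hyw⟩ := hx
      obtain ⟨r, rfl⟩ := Ideal.mem_span_singleton'.mp hw
      obtain ⟨c, r', hr', hr⟩ := exists_sub_mem_maximalIdeal h r
      refine ⟨c, ?_⟩
      have hz : y + r' * x₀ ∈ Z.stalkIdeal p := add_mem hy (hmul _ hr' _ hx₀)
      rw [hmemU, localIdeal, Ideal.mem_comap]
      rw [stalkIdeal, Ideal.mem_comap, HomogeneousLocalization.algebraMap_apply] at hz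
      have hz' := Ideal.mul_mem_left _ (algebraMap _ _ (l ^ 1)) hz
      convert hz' using 1
      have e₀ := algebraMap_mul_val_fraction hl hlp (hL1 b₀)
      have e₁ := algebraMap_mul_val_fraction hl hlp (hL1 b)
      have e₂ := congrArg HomogeneousLocalization.val hyw
      rw [HomogeneousLocalization.val_add, HomogeneousLocalization.val_mul, hr] at e₂
      rw [map_sub, map_smul, smul_eq_C_mul, map_sub, map_mul, ← e₀, ← e₁,
        HomogeneousLocalization.val_add, HomogeneousLocalization.val_mul]
      change _ = x.val at e₂
      change _ * x.val - _ * (_ * x₀.val) = _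
      rw [← e₂]
      ring
    have hUf : ∀ b, b ∈ U ↔ f b = 0 := by
      intro b
      refine ⟨fun hb => hfU hb, fun hb => ?_⟩
      obtain ⟨c, hc⟩ := hkey b
      have hfc : f (b - c • b₀) = 0 := hfU hc
      rw [map_sub, map_smul, hb, zero_sub, neg_eq_zero, smul_eq_mul, mul_eq_zero] at hfc
      simpa [hfc.resolve_right hf₀] using hc
    have hfb : ∀ b, f b = ∑ i, f (Pi.single i 1) * b i := by
      intro b
      conv_lhs => rw [pi_eq_sum_univ' b]
      simp [mul_comm]
    -- The tangent vector consists of the coordinates of the functional `f` with kernel `U`, so its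
    -- derivative of `G` is `f` applied to the gradient.
    refine ⟨fun i => f (Pi.single i 1), fun e G hG => ?_, ?_⟩
    · rw [jet_apply, ← hfb fun i => eval a (pderiv i G), ← hUf, hmemU]
      constructor
      · intro hGQ
        have hGa := (h.mem_iff hG).mp (localIdeal_le hp hGQ)
        exact ⟨hGa, (hgrad e G hG hGa).mp hGQ⟩
      · rintro ⟨hGa, hGL⟩
        exact (hgrad e G hG hGa).mpr hGL
    · rw [tangentLength_of_ne_zero]
      · exact le_antisymm hlen (two_le_length_quotient hlt
          (lt_top_iff_ne_top.mpr (IsLocalRing.maximalIdeal.isMaximal _).ne_top))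
      · intro h0
        refine hf₀ ?_
        rw [hfb]
        exact Finset.sum_eq_zero fun i _ => by rw [congrFun h0 i]; simp

/-- A component contained in a tangent vector has length at most two. -/
lemma localLength_le_two {Z : ZeroDimScheme k n} {p : ProjectiveSpectrum (stdGrading k n)}
    {a v : Fin (n + 1) → k} (h : HasCoordinates p a)
    (hv : ∀ (e : ℕ) (G : MvPolynomial (Fin (n + 1)) k), G.IsHomogeneous e →
      eval a G = 0 → jet a v G = 0 → G ∈ Z.localIdeal p) : Z.localLength p ≤ 2 := by
  refine length_quotient_le_two fun x hx y hy hxI => ?_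
  obtain ⟨⟨e, ⟨g, hg⟩, ⟨s, hs⟩, hsp⟩, rfl⟩ := HomogeneousLocalization.mk_surjective x
  obtain ⟨⟨e', ⟨g', hg'⟩, ⟨s', hs'⟩, hsp'⟩, rfl⟩ := HomogeneousLocalization.mk_surjective y
  change g.IsHomogeneous e at hg
  change s.IsHomogeneous e at hs
  change g'.IsHomogeneous e' at hg'
  change s'.IsHomogeneous e' at hs'
  rw [mk_mem_maximalIdeal_iff] at hx hy
  rw [mk_mem_stalkIdeal_iff] at hxI
  have hga : eval a g = 0 := (h.mem_iff hg).mp hx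
  have hga' : eval a g' = 0 := (h.mem_iff hg').mp hy
  have hsa' : eval a s' ≠ 0 := fun h0 => hsp' ((h.mem_iff hs').mpr h0)
  have hjet : jet a v g ≠ 0 := fun h0 => hxI (hv e g hg hga h0)
  -- Chosen so that the derivative of the numerator of `g' / s' - c * (g / s)` vanishes at `a`.
  set c := eval a s * jet a v g' / (eval a s' * jet a v g) with hc
  refine ⟨HomogeneousLocalization.mk ⟨0, ⟨C c, isHomogeneous_C _ c⟩, 1, p.isPrime.one_notMem⟩, ?_⟩
  have hd : (g' * s - C c * g * s').IsHomogeneous (e' + e) := by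
    refine (hg'.mul hs).sub ?_
    rw [add_comm e' e]
    exact (hg.C_mul c).mul hs'
  have hdmem : g' * s - C c * g * s' ∈ Z.localIdeal p := by
    refine hv _ _ hd (by simp [hga, hga']) ?_
    simp only [map_sub, jet_mul, hga, hga', jet_C, map_mul, eval_C]
    rw [hc]
    field_simp
    ring
  have heq : HomogeneousLocalization.mk ⟨e', ⟨g', hg'⟩, ⟨s', hs'⟩, hsp'⟩ -
      HomogeneousLocalization.mk ⟨0, ⟨C c, isHomogeneous_C _ c⟩, 1, p.isPrime.one_notMem⟩ *
        HomogeneousLocalization.mk ⟨e, ⟨g, hg⟩, ⟨s, hs⟩, hsp⟩ =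
      (HomogeneousLocalization.mk ⟨e' + e, ⟨g' * s - C c * g * s', hd⟩, ⟨s' * s, hs'.mul hs⟩,
        mul_mem hsp' hsp⟩ : LocalRingAt p) := by
    apply HomogeneousLocalization.val_injective
    rw [HomogeneousLocalization.val_sub, HomogeneousLocalization.val_mul]
    simp only [HomogeneousLocalization.val_mk]
    rw [Localization.mk_mul, Localization.sub_mk]
    refine Localization.mk_eq_mk_iff.mpr (Localization.r_of_eq ?_)
    simp
    exact Or.inl (by ring)
  rw [heq, mk_mem_stalkIdeal_iff]
  exact hdmem

/-- A component contained in a reduced point has length at most one. -/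
lemma localLength_le_one {Z : ZeroDimScheme k n} {p : ProjectiveSpectrum (stdGrading k n)}
    {a : Fin (n + 1) → k} (h : HasCoordinates p a)
    (ha : ∀ (e : ℕ) (G : MvPolynomial (Fin (n + 1)) k), G.IsHomogeneous e →
      eval a G = 0 → G ∈ Z.localIdeal p) : Z.localLength p ≤ 1 := by
  refine length_quotient_le_one fun x hx => ?_
  obtain ⟨c, rfl⟩ := HomogeneousLocalization.mk_surjective x
  rw [mk_mem_maximalIdeal_iff] at hx
  rw [mk_mem_stalkIdeal_iff]
  exact ha c.deg _ c.num.2 ((h.mem_iff c.num.2).mp hx)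

end ZeroDimScheme

/-! ### Schemes built from prescribed tangent vectors. -/

lemma mem_of_inf_tangentIdeal_le {S : Finset (ProjectiveSpectrum (stdGrading k n))}
    {a v : ProjectiveSpectrum (stdGrading k n) → Fin (n + 1) → k}
    (h : ∀ p ∈ S, HasCoordinates p (a p)) {q : ProjectiveSpectrum (stdGrading k n)}
    (hq : (S.inf fun p => tangentIdeal (a p) (v p)) ≤ q.asHomogeneousIdeal.toIdeal) : q ∈ S := by
  obtain ⟨p, hp, hpq⟩ := q.isPrime.inf_le'.mp hq
  have hle : p.asHomogeneousIdeal.toIdeal ≤ q.asHomogeneousIdeal.toIdeal := by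
    intro G hG
    rw [(h p hp).eq_tangentIdeal] at hG
    exact q.isPrime.mem_of_pow_mem 2 (hpq (sq_mem_tangentIdeal (v p) hG))
  rw [(h p hp).eq_of_le hle]
  exact hp

/-- The union of the reduced points `p ∈ S` with `v p = 0` and of the tangent vectors `v p` at the
points `p ∈ S` with `v p ≠ 0`, where `a p` are homogeneous coordinates of `p`. -/
def tangentScheme [Infinite k] (S : Finset (ProjectiveSpectrum (stdGrading k n)))
    (a v : ProjectiveSpectrum (stdGrading k n) → Fin (n + 1) → k)
    (h : ∀ p ∈ S, HasCoordinates p (a p)) : ZeroDimScheme k n where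
  ideal := ⟨S.inf fun p => tangentIdeal (a p) (v p), by
    intro e G hG
    rw [Submodule.mem_finsetInf] at hG ⊢
    exact fun p hp => tangentIdeal_isHomogeneous (a p) (v p) e (hG p hp)⟩
  saturated f hf := by
    change f ∈ S.inf fun p => tangentIdeal (a p) (v p)
    rw [Submodule.mem_finsetInf]
    exact fun p hp => mem_tangentIdeal_of_forall_X_mul_mem (h p hp).ne_zero fun i =>
      Submodule.mem_finsetInf.mp (hf i) p hp
  finite_zeroLocus := by
    exact S.finite_toSet.subset fun q hq => mem_of_inf_tangentIdeal_le h hq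

section

variable [Infinite k] {S : Finset (ProjectiveSpectrum (stdGrading k n))}
  {a v : ProjectiveSpectrum (stdGrading k n) → Fin (n + 1) → k}
  (h : ∀ p ∈ S, HasCoordinates p (a p))

lemma mem_tangentScheme_ideal {G : MvPolynomial (Fin (n + 1)) k} :
    G ∈ (tangentScheme S a v h).ideal.toIdeal ↔ ∀ p ∈ S, G ∈ tangentIdeal (a p) (v p) :=
  Submodule.mem_finsetInf

lemma points_tangentScheme_subset : (tangentScheme S a v h).points ⊆ S := by
  exact fun q hq => mem_of_inf_tangentIdeal_le h (ZeroDimScheme.mem_points.mp hq)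

/-- For each other point take a polynomial vanishing there but not at `p`. The product of their
squares is a unit at `p` and lies in the tangent ideals at all the other points. -/
lemma mem_localIdeal_tangentScheme {p : ProjectiveSpectrum (stdGrading k n)}
    {G : MvPolynomial (Fin (n + 1)) k} (hG : G ∈ tangentIdeal (a p) (v p)) :
    G ∈ (tangentScheme S a v h).localIdeal p := by
  classical
  have hsep : ∀ q, ∃ g : MvPolynomial (Fin (n + 1)) k, q ∈ S.erase p →
      g ∈ q.asHomogeneousIdeal.toIdeal ∧ g ∉ p.asHomogeneousIdeal.toIdeal := by
    intro q
    by_cases hq : q ∈ S.erase p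
    · obtain ⟨hqp, hqS⟩ := Finset.mem_erase.mp hq
      have : ¬ q.asHomogeneousIdeal.toIdeal ≤ p.asHomogeneousIdeal.toIdeal := fun hle =>
        hqp ((h q hqS).eq_of_le hle).symm
      obtain ⟨g, hgq, hgp⟩ := SetLike.not_le_iff_exists.mp this
      exact ⟨g, fun _ => ⟨hgq, hgp⟩⟩
    · exact ⟨0, fun hq' => absurd hq' hq⟩
  choose g hg using hsep
  refine ZeroDimScheme.mem_localIdeal.mpr ⟨∏ q ∈ S.erase p, g q ^ 2, fun hmem => ?_, ?_⟩
  · obtain ⟨q, hq, hqg⟩ := p.isPrime.prod_mem_iff.mp hmem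
    exact (hg q hq).2 (p.isPrime.mem_of_pow_mem 2 hqg)
  · rw [mem_tangentScheme_ideal]
    intro q hq
    by_cases hqp : q = p
    · rw [hqp]
      exact Ideal.mul_mem_left _ _ hG
    · have hq' := Finset.mem_erase.mpr ⟨hqp, hq⟩
      refine Ideal.mul_mem_right _ _ (Ideal.mem_of_dvd _ (Finset.dvd_prod_of_mem _ hq') ?_)
      refine sq_mem_tangentIdeal _ ?_
      rw [← (h q hq).eq_tangentIdeal]
      exact (hg q hq').1

lemma localLength_tangentScheme_le {p : ProjectiveSpectrum (stdGrading k n)} (hp : p ∈ S) :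
    (tangentScheme S a v h).localLength p ≤ tangentLength (v p) := by
  by_cases hv : v p = 0
  · rw [hv, tangentLength_zero, Nat.cast_one]
    refine ZeroDimScheme.localLength_le_one (h p hp) fun e G hG hGa => ?_
    refine mem_localIdeal_tangentScheme h ((mem_tangentIdeal_of_isHomogeneous hG).mpr ?_)
    exact ⟨hGa, by rw [hv, jet_zero_right]⟩
  · rw [tangentLength_of_ne_zero hv]
    refine ZeroDimScheme.localLength_le_two (h p hp) (v := v p) fun e G hG hGa hGv => ?_
    exact mem_localIdeal_tangentScheme h
      ((mem_tangentIdeal_of_isHomogeneous hG).mpr ⟨hGa, hGv⟩)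

lemma len_tangentScheme_le :
    (tangentScheme S a v h).len ≤ (∑ p ∈ S, tangentLength (v p) : ℕ) := by
  push_cast
  calc (tangentScheme S a v h).len
      ≤ ∑ p ∈ S, (tangentScheme S a v h).localLength p :=
        Finset.sum_le_sum_of_subset (points_tangentScheme_subset h)
    _ ≤ _ := Finset.sum_le_sum fun p hp => localLength_tangentScheme_le h hp

end

/-! ### Apolarity through the pairing of forms of degree `d`. -/

/-- The pairing of `R` with `S`: the constant term of `G ∘ F`, as a linear functional of `G`. -/
def apolarPairing (F : MvPolynomial (Fin (n + 1)) k) : MvPolynomial (Fin (n + 1)) k →ₗ[k] k :=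
  ∑ α ∈ F.support, (((∏ i, (α i).factorial : ℕ) : k) * coeff α F) • lcoeff k α

lemma apolarPairing_apply (F G : MvPolynomial (Fin (n + 1)) k) :
    apolarPairing F G =
      ∑ α ∈ F.support, ((∏ i, (α i).factorial : ℕ) : k) * coeff α F * coeff α G := by
  simp [apolarPairing]

lemma apolarPairing_monomial (F : MvPolynomial (Fin (n + 1)) k) (δ : Fin (n + 1) →₀ ℕ) (c : k) :
    apolarPairing F (monomial δ c) = ((∏ i, (δ i).factorial : ℕ) : k) * coeff δ F * c := by
  classical
  rw [apolarPairing_apply, Finset.sum_eq_single δ]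
  · simp
  · intro α _ hα
    rw [coeff_monomial, if_neg hα.symm, mul_zero]
  · intro hδ
    rw [notMem_support_iff.mp hδ]
    simp

lemma factorial_mul_coeff_monomialDeriv (β γ : Fin (n + 1) →₀ ℕ)
    (F : MvPolynomial (Fin (n + 1)) k) :
    ((∏ i, (γ i).factorial : ℕ) : k) * coeff γ (monomialDeriv β F) =
      ((∏ i, ((γ + β) i).factorial : ℕ) : k) * coeff (γ + β) F := by
  classical
  rw [monomialDeriv, coeff_sum, Finset.sum_eq_single (γ + β)]
  · rw [add_tsub_cancel_right, coeff_monomial, if_pos rfl, ← mul_assoc, ← Nat.cast_mul,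
      ← Finset.prod_mul_distrib]
    congr 2
    refine Finset.prod_congr rfl fun i _ => ?_
    have := Nat.factorial_mul_descFactorial (n := (γ + β) i) (k := β i) (by simp)
    simpa using this
  · intro α _ hα
    rw [coeff_monomial]
    split_ifs with hγ
    · have hβ : ¬ β ≤ α := fun hβ => hα (by rw [← hγ, tsub_add_cancel_of_le hβ])
      rw [Finsupp.le_def] at hβ
      push Not at hβ
      obtain ⟨i, hi⟩ := hβ
      rw [Finset.prod_eq_zero (Finset.mem_univ i) (Nat.descFactorial_of_lt hi)]
      simp
    · rfl
  · intro hα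
    rw [notMem_support_iff.mp hα]
    simp

lemma factorial_mul_coeff_diffAction (γ : Fin (n + 1) →₀ ℕ)
    (G F : MvPolynomial (Fin (n + 1)) k) :
    ((∏ i, (γ i).factorial : ℕ) : k) * coeff γ (diffAction G F) =
      apolarPairing F (monomial γ 1 * G) := by
  conv_rhs => rw [G.as_sum, Finset.mul_sum, map_sum]
  rw [diffAction, coeff_sum, Finset.mul_sum]
  refine Finset.sum_congr rfl fun β _ => ?_
  rw [monomial_mul, one_mul, apolarPairing_monomial, ← factorial_mul_coeff_monomialDeriv,
    coeff_smul, smul_eq_mul]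
  ring

/-- The pairing of `F` with `Y^γ G` is `γ!` times the coefficient of `X^γ` in `G ∘ F`, and `γ!` is
invertible in characteristic 0. -/
lemma mem_ann_iff [CharZero k] {G F : MvPolynomial (Fin (n + 1)) k} :
    G ∈ Ann F ↔ ∀ γ, apolarPairing F (monomial γ 1 * G) = 0 := by
  simp only [← factorial_mul_coeff_diffAction]
  change diffAction G F = 0 ↔ _
  rw [MvPolynomial.ext_iff]
  refine forall_congr' fun γ => ?_
  have : ((∏ i, (γ i).factorial : ℕ) : k) ≠ 0 :=
    Nat.cast_ne_zero.mpr (Finset.prod_ne_zero_iff.mpr fun i _ => Nat.factorial_ne_zero _)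
  simp [mul_eq_zero, this, -Nat.cast_prod]

lemma apolarPairing_homogeneousComponent {d : ℕ} {F : MvPolynomial (Fin (n + 1)) k}
    (hF : F.IsHomogeneous d) (G : MvPolynomial (Fin (n + 1)) k) :
    apolarPairing F (homogeneousComponent d G) = apolarPairing F G := by
  rw [apolarPairing_apply, apolarPairing_apply]
  refine Finset.sum_congr rfl fun α hα => ?_
  rw [coeff_homogeneousComponent, if_pos]
  rw [hF.degree_eq_sum_deg_support hα]
  rfl

/-- Apolarity to a form of degree `d` only depends on the degree `d` part of the ideal. -/
lemma ZeroDimScheme.isApolar_iff [CharZero k] (Z : ZeroDimScheme k n) {d : ℕ}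
    {F : MvPolynomial (Fin (n + 1)) k} (hF : F.IsHomogeneous d) :
    Z.IsApolar F ↔ ∀ G : MvPolynomial (Fin (n + 1)) k, G.IsHomogeneous d →
      G ∈ Z.ideal.toIdeal → apolarPairing F G = 0 := by
  constructor
  · intro h G _ hGI
    simpa using mem_ann_iff.mp (h hGI) 0
  · intro h G hG
    refine mem_ann_iff.mpr fun γ => ?_
    rw [← apolarPairing_homogeneousComponent hF]
    refine h _ (homogeneousComponent_isHomogeneous d _) ?_
    exact homogeneousComponent_mem_of_mem Z.ideal.isHomogeneous (Ideal.mul_mem_left _ _ hG) d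

end

end Apolarity

namespace Apolarity

noncomputable section

/-! ### Linear algebra of finitely many functionals. -/

section LinearAlgebra

variable {k E ι : Type*} [Field k] [AddCommGroup E] [Module k E]

/-- The common kernel of finitely many independent functionals has the expected codimension. -/
lemma finrank_quotient_of_independent [Fintype ι] (L : ι → E →ₗ[k] k)
    (h : ∀ c : ι → k, (∀ x, ∑ i, c i * L i x = 0) → c = 0) (W : Submodule k E)
    (hW : ∀ x, x ∈ W ↔ ∀ i, L i x = 0) : Module.finrank k (E ⧸ W) = Fintype.card ι := by
  classical
  have hker : W = LinearMap.ker (LinearMap.pi L) := by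
    ext x
    rw [hW, LinearMap.mem_ker, funext_iff]
    rfl
  -- A nonzero functional killing the image would be a linear relation among the `L i`.
  have hsurj : Function.Surjective (LinearMap.pi L) := by
    rw [← LinearMap.range_eq_top]
    by_contra hne
    obtain ⟨f, hf0, hf⟩ := Submodule.exists_le_ker_of_lt_top _ (lt_top_iff_ne_top.mpr hne)
    have hfy : ∀ y, f y = ∑ i, f (Pi.single i 1) * y i := by
      intro y
      conv_lhs => rw [pi_eq_sum_univ' y]
      simp [mul_comm]
    have hc := h (fun i => f (Pi.single i 1)) fun x => by
      have hx : f (LinearMap.pi L x) = 0 := hf ⟨x, rfl⟩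
      rwa [hfy] at hx
    refine hf0 (LinearMap.ext fun y => ?_)
    rw [hfy, LinearMap.zero_apply]
    exact Finset.sum_eq_zero fun i _ => by rw [congrFun hc i, Pi.zero_apply, zero_mul]
  rw [hker, ((LinearMap.pi L).quotKerEquivOfSurjective hsurj).finrank_eq,
    Module.finrank_fintype_fun_eq_card]

/-- A functional vanishing on the common kernel of finitely many functionals is a combination of
them. -/
lemma exists_eq_sum_of_forall_eq_zero (S : Finset ι) (f g : ι → E →ₗ[k] k) (K : E →ₗ[k] k)
    (h : ∀ x, (∀ i ∈ S, f i x = 0 ∧ g i x = 0) → K x = 0) :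
    ∃ c e : ι → k, ∀ x, K x = ∑ i ∈ S, (c i * f i x + e i * g i x) := by
  classical
  have hK : K ∈ Submodule.span k (Set.range (Sum.elim (fun i : S => f i) fun i : S => g i)) := by
    refine mem_span_of_iInf_ker_le_ker fun x hx => h x fun i hi => ?_
    rw [Submodule.mem_iInf] at hx
    exact ⟨hx (Sum.inl ⟨i, hi⟩), hx (Sum.inr ⟨i, hi⟩)⟩
  obtain ⟨c, hc⟩ := (Submodule.mem_span_range_iff_exists_fun k).mp hK
  refine ⟨fun i => if hi : i ∈ S then c (Sum.inl ⟨i, hi⟩) else 0,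
    fun i => if hi : i ∈ S then c (Sum.inr ⟨i, hi⟩) else 0, fun x => ?_⟩
  rw [← hc, ← Finset.sum_attach S, Fintype.sum_sum_type]
  simp [Finset.sum_add_distrib]

end LinearAlgebra

variable {k : Type*} [Field k] {n : ℕ}

/-! ### Independent conditions, the Hilbert function and minimality. -/

/-- The derivatives of a form `G` at the points `x`, in directions `l(x) w` depending linearly on
`x`, are the values of a form of the same degree. -/
lemma exists_form_eval_eq_jet {d : ℕ} {G l : MvPolynomial (Fin (n + 1)) k}
    (hG : G.IsHomogeneous d) (hl : l.IsHomogeneous 1) (w : Fin (n + 1) → k) :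
    ∃ H : MvPolynomial (Fin (n + 1)) k, H.IsHomogeneous d ∧
      ∀ x, eval x H = jet x (eval x l • w) G := by
  rcases d with _ | d
  · refine ⟨0, isHomogeneous_zero _ _ _, fun x => ?_⟩
    rw [totalDegree_eq_zero_iff_eq_C.mp ((totalDegree_zero_iff_isHomogeneous (p := G)).mpr hG),
      jet_C, map_zero]
  -- Differentiation lowers the degree by one and the factor `l` restores it.
  · refine ⟨(∑ i, C (w i) * pderiv i G) * l, ?_, fun x => ?_⟩
    · exact (IsHomogeneous.sum _ _ _ fun i _ => (hG.pderiv (i := i)).C_mul (w i)).mul hl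
    · rw [jet_smul_right, jet_apply, map_mul, map_sum, mul_comm]
      simp

lemma tangentLength_le {v w : Fin (n + 1) → k} (h : w = 0 → v = 0) :
    tangentLength v ≤ tangentLength w := by
  by_cases hw : w = 0
  · rw [hw, h hw]
  · rw [tangentLength_of_ne_zero hw]
    by_cases hv : v = 0
    · simp [hv, tangentLength_zero]
    · rw [tangentLength_of_ne_zero hv]

lemma tangentLength_zero_lt {w : Fin (n + 1) → k} (hw : w ≠ 0) :
    tangentLength (0 : Fin (n + 1) → k) < tangentLength w := by
  rw [tangentLength_zero, tangentLength_of_ne_zero hw]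
  norm_num

lemma sum_tangentLength {ι : Type*} (S : Finset ι) (v : ι → Fin (n + 1) → k)
    [DecidablePred fun p => v p ≠ 0] :
    ∑ p ∈ S, tangentLength (v p) = S.card + (S.filter fun p => v p ≠ 0).card := by
  rw [Finset.card_eq_sum_ones, Finset.card_filter, ← Finset.sum_add_distrib]
  refine Finset.sum_congr rfl fun p _ => ?_
  split_ifs with hp
  · rw [tangentLength_of_ne_zero hp]
  · rw [not_not.mp hp, tangentLength_zero]

/-- The conditions imposed on forms of degree `d` by the tangent vectors `v p` at the points
`a p`, for `p ∈ S`, are independent. -/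
def ImposeIndependentConditions {ι : Type*} (S : Finset ι) (a v : ι → Fin (n + 1) → k) (d : ℕ) :
    Prop :=
  ∀ c e : ι → k, (∀ G : MvPolynomial (Fin (n + 1)) k, G.IsHomogeneous d →
    ∑ p ∈ S, (c p * eval (a p) G + e p * jet (a p) (v p) G) = 0) →
    -- At a reduced point, where `v p = 0`, the coefficient `e p` multiplies the zero functional and
    -- is left free.
    ∀ p ∈ S, c p = 0 ∧ e p • v p = 0

/-- A relation in degree `d + 1`, restricted to multiples `G * l` of a linear form, is by Leibniz a
relation in degree `d`; choosing `l(a p) = 1` recovers the coefficients at `p`. -/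
lemma ImposeIndependentConditions.succ {ι : Type*} {S : Finset ι} {a v : ι → Fin (n + 1) → k}
    {d : ℕ} (h : ImposeIndependentConditions S a v d) (ha : ∀ p ∈ S, a p ≠ 0) :
    ImposeIndependentConditions S a v (d + 1) := by
  intro c e hce p hp
  obtain ⟨l, hl, hla⟩ := exists_linear_form_eval_eq_one (ha p hp)
  have hrel := h (fun q => c q * eval (a q) l + e q * jet (a q) (v q) l)
    (fun q => e q * eval (a q) l) (fun G hG => by
      rw [← hce (G * l) (hG.mul hl)]
      refine Finset.sum_congr rfl fun q _ => ?_
      rw [jet_mul, map_mul]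
      ring) p hp
  rw [hla, mul_one, mul_one, ← jet_smul_right] at hrel
  obtain ⟨h1, h2⟩ := hrel
  rw [h2, jet_zero_right, add_zero] at h1
  exact ⟨h1, h2⟩

namespace ZeroDimScheme

lemma HF_eq_sum_tangentLength (Z : ZeroDimScheme k n) {ι : Type*} {S : Finset ι}
    {a v : ι → Fin (n + 1) → k} {d : ℕ}
    (hmem : ∀ G : MvPolynomial (Fin (n + 1)) k, G.IsHomogeneous d →
      (G ∈ Z.ideal.toIdeal ↔ ∀ p ∈ S, eval (a p) G = 0 ∧ jet (a p) (v p) G = 0))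
    (h : ImposeIndependentConditions S a v d) : Z.HF d = ∑ p ∈ S, tangentLength (v p) := by
  classical
  set T := S.filter fun p => v p ≠ 0 with hT
  -- One functional for each point and a second one for each nonzero tangent vector, as many as the
  -- total length.
  set L : S ⊕ T → stdGrading k n d →ₗ[k] k :=
    Sum.elim (fun p => (aeval (a p)).toLinearMap ∘ₗ (stdGrading k n d).subtype)
      (fun p => jet (a p) (v p) ∘ₗ (stdGrading k n d).subtype) with hL
  have hLl : ∀ (p : S) (x : stdGrading k n d), L (Sum.inl p) x = eval (a p) x.1 := fun p x => by
    simp [hL, aeval_eq_eval]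
  have hLr : ∀ (p : T) (x : stdGrading k n d), L (Sum.inr p) x = jet (a p) (v p) x.1 :=
    fun p x => rfl
  rw [HF, finrank_quotient_of_independent L]
  · rw [sum_tangentLength, Fintype.card_sum, Fintype.card_coe, Fintype.card_coe]
  · intro c hc
    have hTS : ∀ p ∈ T, p ∈ S := fun p hp => (Finset.mem_filter.mp hp).1
    have hind := h (fun p => if hp : p ∈ S then c (Sum.inl ⟨p, hp⟩) else 0)
      (fun p => if hp : p ∈ T then c (Sum.inr ⟨p, hp⟩) else 0) fun G hG => by
        have hG' := hc ⟨G, hG⟩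
        rw [Fintype.sum_sum_type] at hG'
        simp only [hLl, hLr] at hG'
        rw [Finset.sum_add_distrib]
        refine Eq.trans ?_ hG'
        congr 1
        · rw [← Finset.sum_attach S]
          simp
        · rw [← Finset.sum_subset hTS, ← Finset.sum_attach T]
          · simp
          · intro p _ hp
            rw [dif_neg hp, zero_mul]
    ext (⟨p, hp⟩ | ⟨p, hp⟩)
    · have := (hind p hp).1
      rwa [dif_pos hp] at this
    · have := (hind p (hTS p hp)).2
      rw [dif_pos hp, smul_eq_zero] at this
      exact this.resolve_right (Finset.mem_filter.mp hp).2
  · rintro ⟨G, hG⟩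
    have hiff : (⟨G, hG⟩ : stdGrading k n d) ∈ (Z.ideal.toIdeal.restrictScalars k).comap
        (stdGrading k n d).subtype ↔ G ∈ Z.ideal.toIdeal := Iff.rfl
    rw [hiff, hmem G hG]
    constructor
    · rintro hall (⟨p, hp⟩ | ⟨p, hp⟩)
      · rw [hLl]
        exact (hall p hp).1
      · rw [hLr]
        exact (hall p (Finset.mem_filter.mp hp).1).2
    · intro hall p hp
      refine ⟨by simpa [hLl] using hall (Sum.inl ⟨p, hp⟩), ?_⟩
      by_cases hv : v p = 0
      · rw [hv, jet_zero_right]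
      · simpa [hLr] using hall (Sum.inr ⟨p, Finset.mem_filter.mpr ⟨hp, hv⟩⟩)

end ZeroDimScheme

/-- A form with a representation by tangent vectors at the points of `S` that cannot be shortened:
the tangent vectors impose independent conditions. -/
lemma imposeIndependentConditions_of_minimal {ι : Type*} {S : Finset ι}
    {a v : ι → Fin (n + 1) → k} (ha : ∀ p ∈ S, a p ≠ 0) {d : ℕ}
    (ψ : MvPolynomial (Fin (n + 1)) k →ₗ[k] k) (c e : ι → k)
    (hψ : ∀ G : MvPolynomial (Fin (n + 1)) k, G.IsHomogeneous d →
      ψ G = ∑ p ∈ S, (c p * eval (a p) G + e p * jet (a p) (v p) G))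
    (hmin : ∀ S' ⊆ S, ∀ (c' : ι → k) (v' : ι → Fin (n + 1) → k),
      (∀ G : MvPolynomial (Fin (n + 1)) k, G.IsHomogeneous d →
        ψ G = ∑ p ∈ S', (c' p * eval (a p) G + jet (a p) (v' p) G)) →
      ∑ p ∈ S, tangentLength (v p) ≤ ∑ p ∈ S', tangentLength (v' p)) :
    ImposeIndependentConditions S a v d := by
  classical
  intro γ ε hrel
  -- Subtracting `e p / ε p` times the relation removes the tangent vector at `p` and only rescales
  -- the others.
  have hε : ∀ p ∈ S, ε p • v p = 0 := by
    intro p hp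
    by_contra hne
    have hεp : ε p ≠ 0 := fun h0 => hne (by rw [h0, zero_smul])
    have hvp : v p ≠ 0 := fun h0 => hne (by rw [h0, smul_zero])
    have := hmin S subset_rfl (fun q => c q - e p / ε p * γ q)
      (fun q => (e q - e p / ε p * ε q) • v q) fun G hG => by
        rw [← sub_zero (ψ G), ← mul_zero (e p / ε p), ← hrel G hG, hψ G hG, Finset.mul_sum,
          ← Finset.sum_sub_distrib]
        refine Finset.sum_congr rfl fun q _ => ?_
        rw [jet_smul_right]
        ring
    refine this.not_gt (Finset.sum_lt_sum (fun q _ => tangentLength_le fun h0 => ?_) ⟨p, hp, ?_⟩)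
    · rw [h0, smul_zero]
    · rw [div_mul_cancel₀ _ hεp, sub_self, zero_smul]
      exact tangentLength_zero_lt hvp
  have hrel' : ∀ G : MvPolynomial (Fin (n + 1)) k, G.IsHomogeneous d →
      ∑ p ∈ S, γ p * eval (a p) G = 0 := by
    intro G hG
    rw [← hrel G hG]
    refine Finset.sum_congr rfl fun q hq => ?_
    rw [← jet_smul_right, hε q hq, jet_zero_right, add_zero]
  -- Subtracting `c p / γ p` times the relation removes the reduced point `p` altogether.
  have hsimple : ∀ p ∈ S, v p = 0 → γ p = 0 := by
    intro p hp hvp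
    by_contra hne
    have := hmin (S.erase p) (Finset.erase_subset p S) (fun q => c q - c p / γ p * γ q)
      (fun q => e q • v q) fun G hG => by
        rw [← sub_zero (ψ G), ← mul_zero (c p / γ p), ← hrel' G hG, hψ G hG, Finset.mul_sum,
          ← Finset.sum_sub_distrib, ← Finset.add_sum_erase S _ hp, hvp, jet_zero_right]
        rw [show c p * eval (a p) G + e p * 0 - c p / γ p * (γ p * eval (a p) G) = 0 by
          field_simp; ring, zero_add]
        refine Finset.sum_congr rfl fun q _ => ?_
        rw [jet_smul_right]
        ring
    refine this.not_gt ?_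
    rw [← Finset.add_sum_erase S _ hp, hvp, tangentLength_zero]
    refine Nat.lt_one_add_iff.mpr (Finset.sum_le_sum fun q _ => tangentLength_le fun h0 => by
      rw [h0, smul_zero])
  refine fun p hp => ⟨?_, hε p hp⟩
  by_contra hne
  have hvp : v p ≠ 0 := fun h0 => hne (hsimple p hp h0)
  obtain ⟨l, hl, hla⟩ := exists_linear_form_eval_eq_one (ha p hp)
  -- The relation among values, applied to `l * ∂_{v p} G`, relates derivatives along `v p` at all
  -- points. Subtracting it kills the vector at `p`; reduced points stay reduced because `γ`
  -- vanishes there.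
  have := hmin S subset_rfl c
    (fun q => e q • v q - (e p / γ p * γ q * eval (a q) l) • v p) fun G hG => by
      obtain ⟨H, hH, hHx⟩ := exists_form_eval_eq_jet hG hl (v p)
      rw [← sub_zero (ψ G), ← mul_zero (e p / γ p), ← hrel' H hH, hψ G hG, Finset.mul_sum,
        ← Finset.sum_sub_distrib]
      refine Finset.sum_congr rfl fun q _ => ?_
      rw [hHx, jet_sub_right, jet_smul_right, jet_smul_right, jet_smul_right]
      ring
  refine this.not_gt (Finset.sum_lt_sum (fun q hq => tangentLength_le fun h0 => ?_) ⟨p, hp, ?_⟩)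
  · rw [h0, hsimple q hq h0]
    simp
  · rw [hla, mul_one, div_mul_cancel₀ _ hne, sub_self]
    exact tangentLength_zero_lt hvp

end

end Apolarity

open Apolarity in
theorem mainTheorem1 {k : Type*} [Field k] [IsAlgClosed k] [CharZero k] {n d : ℕ}
    (F : MvPolynomial (Fin (n + 1)) k) (hF : F.IsHomogeneous d)
    (Z : Apolarity.ZeroDimScheme k n)
    (hlen : ∀ p ∈ Z.points, Z.localLength p ≤ 2)
    (hmin : Z.IsMinimalApolar F) :
    Z.IsRegularInDegree d := by
  classical
  have : Infinite k := IsAlgClosed.instInfinite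
  have hcoord : ∀ p, ∃ a : Fin (n + 1) → k, p ∈ Z.points → HasCoordinates p a := by
    intro p
    by_cases hp : p ∈ Z.points
    · obtain ⟨a, ha⟩ := Z.exists_hasCoordinates_of_mem_points hp
      exact ⟨a, fun _ => ha⟩
    · exact ⟨0, fun hp' => absurd hp' hp⟩
  choose a ha using hcoord
  have htan : ∀ p, ∃ v : Fin (n + 1) → k, p ∈ Z.points →
      (∀ (e : ℕ) (G : MvPolynomial (Fin (n + 1)) k), G.IsHomogeneous e →
        (G ∈ Z.localIdeal p ↔ eval (a p) G = 0 ∧ jet (a p) v G = 0)) ∧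
      Z.localLength p = tangentLength v := by
    intro p
    by_cases hp : p ∈ Z.points
    · obtain ⟨v, hv⟩ := Z.exists_forall_mem_localIdeal_iff hp (ha p hp) (hlen p hp)
      exact ⟨v, fun _ => hv⟩
    · exact ⟨0, fun hp' => absurd hp' hp⟩
  choose v hv using htan
  have hmem : ∀ (e : ℕ) (G : MvPolynomial (Fin (n + 1)) k), G.IsHomogeneous e →
      (G ∈ Z.ideal.toIdeal ↔
        ∀ p ∈ Z.points, eval (a p) G = 0 ∧ jet (a p) (v p) G = 0) := by
    intro e G hG
    constructor
    · intro hGI p hp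
      rw [← (hv p hp).1 e G hG, ZeroDimScheme.mem_localIdeal]
      exact ⟨1, p.isPrime.one_notMem, by rwa [one_mul]⟩
    · intro hall
      refine Z.mem_ideal_of_forall_points hG fun p hp => ?_
      rw [← ZeroDimScheme.mem_localIdeal, (hv p hp).1 e G hG]
      exact hall p hp
  have hlenZ : Z.len = (∑ p ∈ Z.points, tangentLength (v p) : ℕ) := by
    rw [ZeroDimScheme.len, Nat.cast_sum]
    exact Finset.sum_congr rfl fun p hp => (hv p hp).2
  -- Apolarity makes the functional of `F` vanish on `I(Z)_d`, the common kernel of the conditions.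
  obtain ⟨c, e, hce⟩ := exists_eq_sum_of_forall_eq_zero Z.points
    (fun p => (aeval (a p)).toLinearMap ∘ₗ (stdGrading k n d).subtype)
    (fun p => jet (a p) (v p) ∘ₗ (stdGrading k n d).subtype)
    (apolarPairing F ∘ₗ (stdGrading k n d).subtype) fun x hx =>
      (Z.isApolar_iff hF).mp hmin.1 x.1 x.2 ((hmem d x.1 x.2).mpr fun p hp => by
        simpa [aeval_eq_eval] using hx p hp)
  have hind : ImposeIndependentConditions Z.points a v d := by
    refine imposeIndependentConditions_of_minimal (fun p hp => (ha p hp).ne_zero)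
      (apolarPairing F) c e (fun G hG => ?_) fun S' hS' c' v' hψ => ?_
    · simpa [aeval_eq_eval] using hce ⟨G, hG⟩
    -- Any other such expression of the functional yields an apolar scheme, whose length cannot be
    -- less than that of `Z`.
    · have hS : ∀ p ∈ S', HasCoordinates p (a p) := fun p hp => ha p (hS' hp)
      have hap : (tangentScheme S' a v' hS).IsApolar F := by
        rw [ZeroDimScheme.isApolar_iff _ hF]
        intro G hG hGI
        rw [mem_tangentScheme_ideal] at hGI
        rw [hψ G hG]
        refine Finset.sum_eq_zero fun p hp => ?_
        obtain ⟨h1, h2⟩ := (mem_tangentIdeal_of_isHomogeneous hG).mp (hGI p hp)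
        rw [h1, h2, mul_zero, add_zero]
      have hle := (hmin.2 _ hap).trans (len_tangentScheme_le hS)
      rw [hlenZ] at hle
      exact_mod_cast hle
  have hind' := hind.succ fun p hp => (ha p hp).ne_zero
  refine iInf₂_le d ⟨?_, ?_⟩
  · rw [Z.HF_eq_sum_tangentLength (hmem d) hind, hlenZ]
  · rw [Z.HF_eq_sum_tangentLength (hmem (d + 1)) hind', hlenZ]
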